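/- Let $G=(V,E)$ be a finite undirected graph with $n=|V|$ vertices. An ordering of $V$ is a bijection $\pi:V\to[n]$. With $L_\pi(v)$ and $R_\pi(v)$ the sets of neighbours of $v$ to the left and to the right of $v$, the imbalance of $\pi$ is $\iota(\pi)=\sum_{v\in V}\bigl||R_\pi(v)|-|L_\pi(v)|\bigr|$, and the problem Imbalance asks for an ordering of minimum imbalance. Let $C=\{c_1,\dots,c_k\}$ be a vertex cover of $G$ of size $k$. The type of a vertex $v\in V\setminus C$ is its neighbourhood $N(v)\subseteq C$, and $T$ is the number of types that occur. Let $k\ge 1$ and $n\ge 2$. Let the instance be given succinctly: by $k$, $T$, the adjacency matrix of $G[C]$, the $T\times k$ incidence matrix of the occurring types, and, for each occurring type, the number of vertices of $V\setminus C$ that have it. Let an ordering be described succinctly, too: by the order in which it places $C$ and, for each type $S$ and each $i\in\{0,\dots,k\}$, by the number of vertices of type $S$ that have exactly $i$ vertices of $C$ to their left. There is one algorithm (a program for a unit-cost random access machine on integers whose only arithmetic is addition and subtraction) that on every such instance outputs, in time $$((T+2)k)^{O(k)}\cdot\log_2(kn),$$ the description of an ordering of $V$ such that every ordering with this description has minimum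 imbalance. The constant in $O(k)$ is absolute. -/

import Mathlib

/-! ### The machine model: a unit-cost random access machine, programmed in a structured language

The memory consists of integer variables and integer arrays, each named by a natural number. The
names are fixed in the text of the program, so that a program uses a constant number of variables
and arrays; the position inside an array is computed at run time (indirect addressing). The only
arithmetic is addition and subtraction. -/

namespace RAM

/-- The memory: variable number `x` holds `var x`, and position `i` of array number `a` holds
`arr a i`. -/
structure State where
  var : ℕ → ℤ
  arr : ℕ → ℤ → ℤ

/-- Arithmetic expressions. -/
inductive AExp where
  | const (z : ℤ)
  | var (x : ℕ)
  | read (a : ℕ) (i : AExp)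
  | add (e f : AExp)
  | sub (e f : AExp)

/-- The value of an expression. -/
def AExp.eval (s : State) : AExp → ℤ
  | .const z => z
  | .var x => s.var x
  | .read a i => s.arr a (i.eval s)
  | .add e f => e.eval s + f.eval s
  | .sub e f => e.eval s - f.eval s

/-- The time for the evaluation of an expression: one unit for every constant, every memory access
and every addition or subtraction. -/
def AExp.cost : AExp → ℕ
  | .const _ => 1
  | .var _ => 1
  | .read _ i => i.cost + 1
  | .add e f => e.cost + f.cost + 1
  | .sub e f => e.cost + f.cost + 1

/-- Programs. The tests of `ite e p q` and of `loop e p` ("while") are both `0 < e`. -/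
inductive Prog where
  | skip
  | assign (x : ℕ) (e : AExp)
  | write (a : ℕ) (i e : AExp)
  | seq (p q : Prog)
  | ite (e : AExp) (p q : Prog)
  | loop (e : AExp) (p : Prog)

/-- The memory after variable `x` has been set to `z`. -/
def State.setVar (s : State) (x : ℕ) (z : ℤ) : State :=
  { s with var := Function.update s.var x z }

/-- The memory after position `i` of array `a` has been set to `z`. -/
def State.setArr (s : State) (a : ℕ) (i z : ℤ) : State :=
  { s with arr := Function.update s.arr a (Function.update (s.arr a) i z) }

/-- `Exec p s n s'`: the program `p`, started in memory `s`, halts in memory `s'` after exactly `n`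
units of time. -/
inductive Exec : Prog → State → ℕ → State → Prop where
  | skip (s : State) : Exec .skip s 1 s
  | assign (x : ℕ) (e : AExp) (s : State) :
      Exec (.assign x e) s (e.cost + 1) (s.setVar x (e.eval s))
  | write (a : ℕ) (i e : AExp) (s : State) :
      Exec (.write a i e) s (i.cost + e.cost + 1) (s.setArr a (i.eval s) (e.eval s))
  | seq {p q : Prog} {s s' s'' : State} {m n : ℕ} :
      Exec p s m s' → Exec q s' n s'' → Exec (.seq p q) s (m + n) s''
  | ite_true {e : AExp} {p q : Prog} {s s' : State} {n : ℕ} :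
      0 < e.eval s → Exec p s n s' → Exec (.ite e p q) s (e.cost + 1 + n) s'
  | ite_false {e : AExp} {p q : Prog} {s s' : State} {n : ℕ} :
      ¬ 0 < e.eval s → Exec q s n s' → Exec (.ite e p q) s (e.cost + 1 + n) s'
  | loop_true {e : AExp} {p : Prog} {s s' s'' : State} {m n : ℕ} :
      0 < e.eval s → Exec p s m s' → Exec (.loop e p) s' n s'' →
      Exec (.loop e p) s (e.cost + 1 + m + n) s''
  | loop_false {e : AExp} {p : Prog} {s : State} :
      ¬ 0 < e.eval s → Exec (.loop e p) s (e.cost + 1) s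

end RAM

/-! ### The imbalance problem -/

namespace Imbalance

variable {V : Type*} [Fintype V]

/-- An ordering of the vertices: a bijection onto `n` consecutive positions. -/
abbrev Ordering (V : Type*) [Fintype V] : Type _ := V ≃ Fin (Fintype.card V)

/-- The left neighbours of `v`. -/
def left (G : SimpleGraph V) (π : Ordering V) (v : V) : Set V := {u | G.Adj v u ∧ π u < π v}

/-- The right neighbours of `v`. -/
def right (G : SimpleGraph V) (π : Ordering V) (v : V) : Set V := {u | G.Adj v u ∧ π v < π u}

/-- The imbalance at `v`. -/
noncomputable def imbalanceAt (G : SimpleGraph V) (π : Ordering V) (v : V) : ℤ :=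
  |((right G π v).ncard : ℤ) - ((left G π v).ncard : ℤ)|

/-- The total imbalance of an ordering. -/
noncomputable def imbalance (G : SimpleGraph V) (π : Ordering V) : ℤ :=
  ∑ v, imbalanceAt G π v

/-- The ordering `π` solves the imbalance problem for `G`. -/
def IsOptimal (G : SimpleGraph V) (π : Ordering V) : Prop :=
  ∀ ρ : Ordering V, imbalance G π ≤ imbalance G ρ

/-- The vertex types that occur with respect to a vertex cover `C`: the neighbourhoods of the
vertices outside `C`. -/
def vertexTypes (G : SimpleGraph V) (C : Set V) : Set (Set V) :=
  {S | ∃ v, v ∉ C ∧ G.neighborSet v = S}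

section Encoding

variable {C : Set V} {k T : ℕ}

open Classical in
/-- The memory that presents the graph `G` with the vertex cover `C = {c 0, …, c (k-1)}` and the
occurring types `τ 0, …, τ (T-1)`; everything that is not listed is `0`.
* variable `0` is `k` and variable `1` is `T`;
* array `0` is the adjacency matrix of `C`, row by row;
* array `1` is the matrix, row by row, that tells which cover vertices belong to which type;
* array `2` holds, for each type, the number of vertices outside `C` of that type. -/
noncomputable def input (G : SimpleGraph V) (c : Fin k ≃ C) (τ : Fin T ≃ vertexTypes G C) :
    RAM.State where
  var x := if x = 0 then (k : ℤ) else if x = 1 then (T : ℤ) else 0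
  arr a z :=
    if a = 0 then
      if ∃ i j : Fin k, z = (i : ℤ) * k + j ∧ G.Adj (c i) (c j) then 1 else 0
    else if a = 1 then
      if ∃ (t : Fin T) (i : Fin k), z = (t : ℤ) * k + i ∧ (c i : V) ∈ (τ t : Set V) then 1 else 0
    else if a = 2 then
      ∑ t : Fin T,
        if z = (t : ℤ) then ({v | v ∉ C ∧ G.neighborSet v = τ t}.ncard : ℤ) else 0
    else 0

/-- The slot of a vertex `v` outside the cover `C`: the number of cover vertices to its left. -/
noncomputable def slot (C : Set V) (π : Ordering V) (v : V) : ℕ :=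
  {u | u ∈ C ∧ π u < π v}.ncard

/-- The memory `s` describes the ordering `π`: array `3` lists (the indices of) the cover vertices
from left to right, and array `4` is the matrix, row by row, that tells how many vertices of each
type lie in each of the slots `0, …, k`. -/
def Describes (G : SimpleGraph V) (c : Fin k ≃ C) (τ : Fin T ≃ vertexTypes G C)
    (s : RAM.State) (π : Ordering V) : Prop :=
  (∃ σ : Equiv.Perm (Fin k),
      (∀ i j : Fin k, i < j → π (c (σ i)) < π (c (σ j))) ∧
      ∀ i : Fin k, s.arr 3 (i : ℤ) = ((σ i : Fin k) : ℕ)) ∧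
  ∀ (t : Fin T) (i : Fin (k + 1)),
    s.arr 4 ((t : ℤ) * (k + 1) + i) =
      ({v | v ∉ C ∧ G.neighborSet v = τ t ∧ slot C π v = i}.ncard : ℤ)

end Encoding

end Imbalance

/-! Fix the order in which the cover is placed and let `z t i` be the number of vertices of type `t`
in slot `i`. A vertex outside the cover has all its neighbours in the cover, so its imbalance is a
weight that depends only on `t` and `i`. The signed imbalance of the `j`-th cover vertex is a linear
form in `z`, with coefficients in {-1, 0, 1}, plus a constant from the cover. Hence the imbalance is
a linear function of `z` plus a sum of `k` absolute values |form - target| (`imbalance_eq_cost`),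
and every nonnegative `z` whose block sums are the type counts comes from an ordering
(`exists_ordering`). There are at most k^k orders of the cover, so it remains to solve one such
integer program per order, with only a logarithmic dependence on the counts.

For this, keep a table with a best vector for every target in a box of radius R = 4(T+2)k, and read
the type counts bit by bit from the top. When all block sums double, a feasible vector splits into
two almost equal halves, whose linear forms differ by at most T(k+1); the target splits along with
it, without loss in the absolute values, into two targets of about half the size (`exists_split`).
Conversely, the objective is subadditive. So the best sums of two old entries form the new table
(`IsTable.double`). A bit equal to one adds one vertex to a block, which moves the target by at most
1 in each coordinate and costs one unit of radius (`IsTable.add_unit`). The T blocks cost at most T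
units, and the next doubling makes up for this loss.

The table has (2R+1)^k entries, so one stage takes time ((T+2)k)^{O(k)}, and there are O(log n)
stages. Numbers of the size of the counts are only added, subtracted and compared; multiplication
and division are loops whose lengths depend on k and T alone. The running time is tracked as X^c
(Y+1), where X bounds all loops except those over bits, Y bounds the number of bits, and c is
computed from the text of the program. -/

namespace RAM

/-! ### Specifications of program fragments with time bounds -/

/-- Code for an expression, as a function of the first free variable: it leaves the value there and
changes no earlier variable and no array. Its time will be bounded by the `c`-th power of a
parameter. -/
def Code (_c : ℕ) : Type := ℕ → Prog

/-- Code that works on the arrays, as a function of the first free variable: it changes no earlier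
variable. -/
def Routine (_c : ℕ) : Type := ℕ → Prog

/-- The values of an initial segment of the variables. -/
structure Ctx where
  size : ℕ
  val : ℕ → ℤ

/-- The memory agrees with the context. -/
def Ctx.Fits (Γ : Ctx) (s : State) : Prop := ∀ x < Γ.size, s.var x = Γ.val x

/-- The context `Δ` extends `Γ`. -/
def Ctx.Ext (Γ Δ : Ctx) : Prop := Γ.size ≤ Δ.size ∧ ∀ x < Γ.size, Δ.val x = Γ.val x

theorem Ctx.Ext.trans {Γ Δ Θ : Ctx} (h : Γ.Ext Δ) (h' : Δ.Ext Θ) : Γ.Ext Θ :=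
  ⟨h.1.trans h'.1, fun x hx => (h'.2 x (hx.trans_le h.1)).trans (h.2 x hx)⟩

theorem Ctx.Ext.fits {Γ Δ : Ctx} (h : Γ.Ext Δ) {s : State} (hs : Δ.Fits s) : Γ.Fits s :=
  fun x hx => (hs x (hx.trans_le h.1)).trans (h.2 x hx)

/-- The code `e` computes `z` in time `X ^ c` in every memory with the arrays `A` that fits `Γ`. -/
def Ev (X : ℕ) (A : ℕ → ℤ → ℤ) (Γ : Ctx) {c : ℕ} (e : Code c) (z : ℤ) : Prop :=
  ∀ l ≥ Γ.size, ∀ s : State, s.arr = A → Γ.Fits s →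
    ∃ n s', Exec (e l) s n s' ∧ n ≤ X ^ c ∧ s'.arr = A ∧ s'.var l = z ∧
      ∀ x < l, s'.var x = s.var x

/-- The routine `p`, started with the arrays `A` in a memory that fits `Γ`, halts within time
`X ^ c * (Y + 1)` with arrays that satisfy `Q`. -/
def Tr (X Y : ℕ) (Γ : Ctx) {c : ℕ} (p : Routine c) (A : ℕ → ℤ → ℤ) (Q : (ℕ → ℤ → ℤ) → Prop) :
    Prop :=
  ∀ l ≥ Γ.size, ∀ s : State, s.arr = A → Γ.Fits s →
    ∃ n s', Exec (p l) s n s' ∧ n ≤ X ^ c * (Y + 1) ∧ Q s'.arr ∧ ∀ x < l, s'.var x = s.var x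

variable {X Y : ℕ} {A : ℕ → ℤ → ℤ} {Γ Δ : Ctx} {a b c d : ℕ}

theorem Ev.mono {e : Code c} {z : ℤ} (h : Ev X A Γ e z) (hΔ : Γ.Ext Δ) : Ev X A Δ e z :=
  fun l hl s hs hf => h l (hΔ.1.trans hl) s hs (hΔ.fits hf)

theorem Tr.imp {p : Routine c} {Q Q' : (ℕ → ℤ → ℤ) → Prop} (h : Tr X Y Γ p A Q)
    (hQ : ∀ A', Q A' → Q' A') : Tr X Y Γ p A Q' := by
  intro l hl s hs hf
  obtain ⟨n, s', h1, h2, h3, h4⟩ := h l hl s hs hf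
  exact ⟨n, s', h1, h2, hQ _ h3, h4⟩

/-! ### Code for expressions -/

namespace Code

def num (z : ℤ) : Code 1 := fun l => .assign l (.const z)

def var (x : ℕ) : Code 1 := fun l => .assign l (.var x)

def read (a : ℕ) (e : Code c) : Code (c + 2) := fun l =>
  .seq (e l) (.assign l (.read a (.var l)))

def add (e : Code a) (f : Code b) : Code (a + b + 3) := fun l =>
  .seq (e l) (.seq (f (l + 1)) (.assign l (.add (.var l) (.var (l + 1)))))

def sub (e : Code a) (f : Code b) : Code (a + b + 3) := fun l =>
  .seq (e l) (.seq (f (l + 1)) (.assign l (.sub (.var l) (.var (l + 1)))))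

/-- The value of `t` if `e < f`, and the value of `u` otherwise. -/
def ifLt (e : Code a) (f : Code b) (t : Code c) (u : Code d) : Code (a + b + c + d + 3) := fun l =>
  .seq (e l) (.seq (f (l + 1)) (.ite (.sub (.var (l + 1)) (.var l)) (t l) (u l)))

/-- Starting with the value of `i`, replace the value `y` by `f x y` for `x = 0, …, n - 1`. -/
def fold (n : Code a) (i : Code b) (f : Code 1 → Code 1 → Code c) : Code (a + b + c + 6) := fun l =>
  .seq (i l) (.seq (n (l + 1)) (.seq (.assign (l + 2) (.const 0))
    (.loop (.sub (.var (l + 1)) (.var (l + 2)))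
      (.seq (f (var (l + 2)) (var l) (l + 3)) (.seq (.assign l (.var (l + 3)))
        (.assign (l + 2) (.add (.var (l + 2)) (.const 1))))))))

end Code

section Rules

variable [hX : X.AtLeastTwo]

/-- Since X ≥ 2, a constant factor of at most 2^q is absorbed by adding q to the exponent. This is
the origin of all the additive constants in the indices of `Code` and `Routine`. -/
theorem time_le {m n p : ℕ} (q : ℕ) (hm : m ≤ X ^ p * n) (hn : n ≤ 2 ^ q) : m ≤ X ^ (p + q) :=
  hm.trans <| by
    rw [pow_add]
    exact Nat.mul_le_mul_left _ (hn.trans (Nat.pow_le_pow_left hX.prop q))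

theorem pos_of_atLeastTwo : 0 < X := by have := hX.prop; omega

theorem one_le_pow_X (n : ℕ) : 1 ≤ X ^ n := Nat.one_le_pow _ _ pos_of_atLeastTwo

theorem pow_le_pow_X {m n : ℕ} (h : m ≤ n) : X ^ m ≤ X ^ n :=
  Nat.pow_le_pow_right pos_of_atLeastTwo h

theorem Ev.num (z : ℤ) : Ev X A Γ (Code.num z) z := by
  intro l hl s hs hf
  refine ⟨_, _, Exec.assign l _ s, ?_, hs, by simp [State.setVar, AExp.eval], ?_⟩
  · simpa [AExp.cost] using hX.prop
  · intro x hx; simp [State.setVar, hx.ne]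

theorem Ev.var {x : ℕ} (h : x < Γ.size) : Ev X A Γ (Code.var x) (Γ.val x) := by
  intro l hl s hs hf
  refine ⟨_, _, Exec.assign l _ s, ?_, hs, by simp [State.setVar, AExp.eval, hf x h], ?_⟩
  · simpa [AExp.cost] using hX.prop
  · intro x hx; simp [State.setVar, hx.ne]

theorem Ev.read {e : Code c} {z : ℤ} (i : ℕ) (h : Ev X A Γ e z) :
    Ev X A Γ (Code.read i e) (A i z) := by
  intro l hl s hs hf
  obtain ⟨n, s1, h1, h2, h3, h4, h5⟩ := h l hl s hs hf
  refine ⟨_, _, h1.seq (Exec.assign l _ s1), ?_, h3, by simp [State.setVar, AExp.eval, h3, h4], ?_⟩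
  · refine time_le (n := 4) 2 ?_ (by norm_num)
    have := one_le_pow_X (X := X) c
    simp [AExp.cost]; omega
  · intro x hx; simp [State.setVar, hx.ne, h5 x hx]

theorem Ev.two {e : Code a} {f : Code b} {y z : ℤ} (he : Ev X A Γ e y) (hf : Ev X A Γ f z) {l : ℕ}
    (hl : l ≥ Γ.size) {s : State} (hs : s.arr = A) (hΓ : Γ.Fits s) :
    ∃ m n s' s'', Exec (e l) s m s' ∧ Exec (f (l + 1)) s' n s'' ∧ m ≤ X ^ (a + b) ∧
      n ≤ X ^ (a + b) ∧ s''.arr = A ∧ s''.var l = y ∧ s''.var (l + 1) = z ∧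
      ∀ x < l, s''.var x = s.var x := by
  obtain ⟨m, s', h1, h2, h3, h4, h5⟩ := he l hl s hs hΓ
  obtain ⟨n, s'', h1', h2', h3', h4', h5'⟩ := hf (l + 1) (hl.trans l.le_succ) s' h3
    (fun x hx => (h5 x (hx.trans_le hl)).trans (hΓ x hx))
  refine ⟨m, n, s', s'', h1, h1', h2.trans (pow_le_pow_X (by omega)),
    h2'.trans (pow_le_pow_X (by omega)), h3', ?_, h4', ?_⟩
  · rw [h5' l (by omega), h4]
  · intro x hx; rw [h5' x (by omega), h5 x hx]

theorem Ev.add {e : Code a} {f : Code b} {y z : ℤ} (he : Ev X A Γ e y) (hf : Ev X A Γ f z) :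
    Ev X A Γ (e.add f) (y + z) := by
  intro l hl s hs hΓ
  obtain ⟨m, n, s', s'', h1, h2, h3, h4, h5, h6, h7, h8⟩ := he.two hf hl hs hΓ
  refine ⟨_, _, h1.seq (h2.seq (Exec.assign l _ s'')), ?_, h5,
    by simp [State.setVar, AExp.eval, h6, h7], ?_⟩
  · refine time_le (n := 6) 3 ?_ (by norm_num)
    have := one_le_pow_X (X := X) (a + b)
    simp [AExp.cost]; omega
  · intro x hx; simp [State.setVar, hx.ne, h8 x hx]

theorem Ev.sub {e : Code a} {f : Code b} {y z : ℤ} (he : Ev X A Γ e y) (hf : Ev X A Γ f z) :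
    Ev X A Γ (e.sub f) (y - z) := by
  intro l hl s hs hΓ
  obtain ⟨m, n, s', s'', h1, h2, h3, h4, h5, h6, h7, h8⟩ := he.two hf hl hs hΓ
  refine ⟨_, _, h1.seq (h2.seq (Exec.assign l _ s'')), ?_, h5,
    by simp [State.setVar, AExp.eval, h6, h7], ?_⟩
  · refine time_le (n := 6) 3 ?_ (by norm_num)
    have := one_le_pow_X (X := X) (a + b)
    simp [AExp.cost]; omega
  · intro x hx; simp [State.setVar, hx.ne, h8 x hx]

theorem Ev.ifLt {e : Code a} {f : Code b} {t : Code c} {u : Code d} {y z v w : ℤ}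
    (he : Ev X A Γ e y) (hf : Ev X A Γ f z) (ht : y < z → Ev X A Γ t v)
    (hu : ¬ y < z → Ev X A Γ u w) : Ev X A Γ (Code.ifLt e f t u) (if y < z then v else w) := by
  intro l hl s hs hΓ
  obtain ⟨m, n, s', s'', h1, h2, h3, h4, h5, h6, h7, h8⟩ := he.two hf hl hs hΓ
  have hΓ' : Γ.Fits s'' := fun x hx => (h8 x (hx.trans_le hl)).trans (hΓ x hx)
  have hab := pow_le_pow_X (X := X) (show a + b ≤ a + b + c + d by omega)
  have h1ab := one_le_pow_X (X := X) (a + b + c + d)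
  split_ifs with hyz
  · obtain ⟨n', s3, k1, k2, k3, k4, k5⟩ := ht hyz l hl s'' h5 hΓ'
    refine ⟨_, _, h1.seq (h2.seq (Exec.ite_true ?_ k1)), ?_, k3, k4, ?_⟩
    · simp [AExp.eval, h6, h7, hyz]
    · refine time_le (n := 7) 3 ?_ (by norm_num)
      have := pow_le_pow_X (X := X) (show c ≤ a + b + c + d by omega)
      simp [AExp.cost]; omega
    · intro x hx; rw [k5 x hx, h8 x hx]
  · obtain ⟨n', s3, k1, k2, k3, k4, k5⟩ := hu hyz l hl s'' h5 hΓ'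
    refine ⟨_, _, h1.seq (h2.seq (Exec.ite_false ?_ k1)), ?_, k3, k4, ?_⟩
    · simp [AExp.eval, h6, h7]; omega
    · refine time_le (n := 7) 3 ?_ (by norm_num)
      have := pow_le_pow_X (X := X) (show d ≤ a + b + c + d by omega)
      simp [AExp.cost]; omega
    · intro x hx; rw [k5 x hx, h8 x hx]

/-- A loop whose test counts down from `N` and whose body takes time `t` at most. -/
theorem Exec.loop_of_count {e : AExp} {p : Prog} {t : ℕ} (I : ℕ → State → Prop) (N : ℕ)
    (h0 : ∀ s, I N s → ¬ 0 < e.eval s)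
    (h1 : ∀ m < N, ∀ s, I m s → 0 < e.eval s ∧ ∃ n s', Exec p s n s' ∧ n ≤ t ∧ I (m + 1) s') :
    ∀ s, I 0 s → ∃ n s', Exec (.loop e p) s n s' ∧ n ≤ N * (e.cost + 1 + t) + (e.cost + 1) ∧
      I N s' := by
  suffices H : ∀ r m, m + r = N → ∀ s, I m s → ∃ n s', Exec (.loop e p) s n s' ∧
      n ≤ r * (e.cost + 1 + t) + (e.cost + 1) ∧ I N s' from fun s hs => H N 0 (by omega) s hs
  intro r
  induction r with
  | zero =>
    intro m hm s hs
    obtain rfl : m = N := by omega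
    exact ⟨_, s, Exec.loop_false (h0 s hs), by omega, hs⟩
  | succ r ih =>
    intro m hm s hs
    obtain ⟨hpos, n, s', he, hn, hs'⟩ := h1 m (by omega) s hs
    obtain ⟨n', s'', he', hn', hs''⟩ := ih (m + 1) (by omega) s' hs'
    exact ⟨_, s'', Exec.loop_true hpos he he', by rw [Nat.succ_mul]; omega, hs''⟩

/-- Variable `l` is the accumulator, `l + 1` the bound and `l + 2` the counter. The number of passes
is at most X, so the loop costs one more factor X. The body receives the counter and the accumulator
as codes, and has to work in every extension of the context. -/
theorem Ev.fold {n : Code a} {i : Code b} {f : Code 1 → Code 1 → Code c} {N : ℕ} (g : ℕ → ℤ)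
    (hN : N ≤ X) (hn : Ev X A Γ n N) (hi : Ev X A Γ i (g 0))
    (hf : ∀ Δ x y m, Γ.Ext Δ → m < N → Ev X A Δ x (m : ℤ) → Ev X A Δ y (g m) →
      Ev X A Δ (f x y) (g (m + 1))) :
    Ev X A Γ (Code.fold n i f) (g N) := by
  intro l hl s hs hΓ
  obtain ⟨n1, n2, s', s'', h1, h2, h3, h4, h5, h6, h7, h8⟩ := hi.two hn hl hs hΓ
  obtain ⟨n3, s3, k1, k2, k3⟩ := Exec.loop_of_count (e := .sub (.var (l + 1)) (.var (l + 2)))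
    (p := .seq (f (.var (l + 2)) (.var l) (l + 3)) (.seq (.assign l (.var (l + 3)))
        (.assign (l + 2) (.add (.var (l + 2)) (.const 1))))) (t := X ^ c + 6)
    (fun m s3 => s3.arr = A ∧ s3.var l = g m ∧ s3.var (l + 1) = N ∧ s3.var (l + 2) = m ∧
      ∀ x < l, s3.var x = s.var x) N
    (by
      rintro s3 ⟨-, -, e1, e2, -⟩
      simp [AExp.eval, e1, e2])
    (by
      rintro m hm s3 ⟨e0, e1, e2, e3, e4⟩
      refine ⟨by simp [AExp.eval, e2, e3, hm], ?_⟩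
      -- The context of a pass is a snapshot of the first `l + 3` variables; the body may overwrite
      -- only later ones.
      have hΔ : Γ.Ext ⟨l + 3, s3.var⟩ :=
        ⟨by simp; omega, fun x hx => (e4 x (hx.trans_le hl)).trans (hΓ x hx)⟩
      have hx := Ev.var (X := X) (A := A) (Γ := ⟨l + 3, s3.var⟩) (x := l + 2) (by simp)
      have hy := Ev.var (X := X) (A := A) (Γ := ⟨l + 3, s3.var⟩) (x := l) (by simp)
      simp only [e3] at hx
      simp only [e1] at hy
      obtain ⟨n4, s4, j1, j2, j3, j4, j5⟩ := hf _ _ _ m hΔ hm hx hy (l + 3) le_rfl s3 e0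
        (fun _ _ => rfl)
      refine ⟨_, _, j1.seq ((Exec.assign _ _ _).seq (Exec.assign _ _ _)), ?_, ?_, ?_, ?_, ?_, ?_⟩
      · simp [AExp.cost]; omega
      · exact j3
      · simp [State.setVar, AExp.eval, j4]
      · simp [State.setVar, j5, e2]
      · simp [State.setVar, AExp.eval, j5, e3]
      · intro x hx
        have h1 : x ≠ l := by omega
        have h2 : x ≠ l + 2 := by omega
        simp [State.setVar, h1, h2, j5 x (by omega), e4 x hx])
    (s''.setVar (l + 2) 0)
    (by
      refine ⟨h5, by simp [State.setVar, h6], by simp [State.setVar, h7], by simp [State.setVar], ?_⟩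
      intro x hx
      have h2 : x ≠ l + 2 := by omega
      simp [State.setVar, h2, h8 x hx])
  refine ⟨_, s3, h1.seq (h2.seq ((Exec.assign _ _ _).seq k1)), ?_, k3.1, k3.2.1, k3.2.2.2.2⟩
  refine (time_le (p := a + b + c + 1) (n := 19) 5 ?_ (by norm_num)).trans (pow_le_pow_X (by omega))
  have e1 : N * (X ^ c + 10) ≤ X ^ (a + b + c + 1) * 11 := by
    calc N * (X ^ c + 10) ≤ X * (X ^ c * 11) := by
          apply Nat.mul_le_mul hN
          have := one_le_pow_X (X := X) c
          omega
      _ = X ^ (c + 1) * 11 := by ring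
      _ ≤ _ := Nat.mul_le_mul_right _ (pow_le_pow_X (by omega))
  have e2 := pow_le_pow_X (X := X) (show b + a ≤ a + b + c + 1 by omega)
  have e3 := one_le_pow_X (X := X) (a + b + c + 1)
  have e4 : N * (1 + 1 + 1 + 1 + (X ^ c + 6)) = N * (X ^ c + 10) := by ring
  simp only [AExp.cost] at k2 ⊢
  omega

/-! ### Routines -/

namespace Routine

def skip : Routine 1 := fun _ => .skip

def write (i : ℕ) (e : Code a) (f : Code b) : Routine (a + b + 3) := fun l =>
  .seq (e l) (.seq (f (l + 1)) (.write i (.var l) (.var (l + 1))))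

def seq (p : Routine a) (q : Routine b) : Routine (a + b + 1) := fun l => .seq (p l) (q l)

def bind (e : Code a) (f : Code 1 → Routine b) : Routine (a + b + 1) := fun l =>
  .seq (e l) (f (Code.var l) (l + 1))

def ifLt (e : Code a) (f : Code b) (p : Routine c) (q : Routine d) : Routine (a + b + c + d + 3) :=
  fun l => .seq (e l) (.seq (f (l + 1)) (.ite (.sub (.var (l + 1)) (.var l)) (p l) (q l)))

def forTo (n : Code a) (f : Code 1 → Routine b) : Routine (a + b + 5) := fun l =>
  .seq (n l) (.seq (.assign (l + 1) (.const 0)) (.loop (.sub (.var l) (.var (l + 1)))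
    (.seq (f (Code.var (l + 1)) (l + 2))
      (.assign (l + 1) (.add (.var (l + 1)) (.const 1))))))

/-- Write the powers of two that are at most the value of `e` into array `i`, and continue with
their number. -/
def powersOfTwo (i : ℕ) (e : Code a) (f : Code 1 → Routine b) : Routine (a + b + 5) := fun l =>
  .seq (e l) (.seq (.assign (l + 1) (.const 1)) (.seq (.assign (l + 2) (.const 0))
    (.seq (.loop (.add (.sub (.var l) (.var (l + 1))) (.const 1))
      (.seq (.write i (.var (l + 2)) (.var (l + 1)))
        (.seq (.assign (l + 1) (.add (.var (l + 1)) (.var (l + 1))))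
          (.assign (l + 2) (.add (.var (l + 2)) (.const 1))))))
      (f (Code.var (l + 2)) (l + 3)))))

end Routine

/-- The arrays after position `z` of array `i` has been set to `w`. -/
def setArr (A : ℕ → ℤ → ℤ) (i : ℕ) (z w : ℤ) : ℕ → ℤ → ℤ :=
  Function.update A i (Function.update (A i) z w)

variable {Q : (ℕ → ℤ → ℤ) → Prop}

theorem timeY_le {m n p : ℕ} (q : ℕ) (hm : m ≤ X ^ p * (Y + 1) * n) (hn : n ≤ 2 ^ q) :
    m ≤ X ^ (p + q) * (Y + 1) :=
  hm.trans <| by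
    rw [pow_add, mul_assoc, mul_assoc, mul_comm (Y + 1)]
    exact Nat.mul_le_mul_left _
      (Nat.mul_le_mul_right _ (hn.trans (Nat.pow_le_pow_left hX.prop q)))

theorem pow_mul_le {m n : ℕ} (h : m ≤ n) : X ^ m * (Y + 1) ≤ X ^ n * (Y + 1) :=
  Nat.mul_le_mul_right _ (pow_le_pow_X h)

theorem pow_le_pow_mul {m n : ℕ} (h : m ≤ n) : X ^ m ≤ X ^ n * (Y + 1) :=
  (pow_le_pow_X h).trans (Nat.le_mul_of_pos_right _ (by omega))

theorem one_le_pow_mul (n : ℕ) : 1 ≤ X ^ n * (Y + 1) :=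
  (one_le_pow_X n).trans (Nat.le_mul_of_pos_right _ (by omega))

theorem Tr.skip (h : Q A) : Tr X Y Γ Routine.skip A Q := by
  intro l hl s hs hf
  exact ⟨_, s, Exec.skip s, one_le_pow_mul 1, hs ▸ h, fun _ _ => rfl⟩

theorem Tr.write {e : Code a} {f : Code b} {y z : ℤ} (i : ℕ) (he : Ev X A Γ e y)
    (hf : Ev X A Γ f z) (hQ : Q (setArr A i y z)) : Tr X Y Γ (Routine.write i e f) A Q := by
  intro l hl s hs hΓ
  obtain ⟨m, n, s', s'', h1, h2, h3, h4, h5, h6, h7, h8⟩ := he.two hf hl hs hΓ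
  refine ⟨_, _, h1.seq (h2.seq (Exec.write i _ _ s'')), ?_, ?_, ?_⟩
  · refine timeY_le (n := 5) 3 ?_ (by norm_num)
    have := one_le_pow_mul (X := X) (Y := Y) (a + b)
    have := pow_le_pow_mul (X := X) (Y := Y) (le_refl (a + b))
    simp [AExp.cost]; omega
  · simpa [State.setArr, AExp.eval, h5, h6, h7, setArr] using hQ
  · intro x hx; simp [State.setArr, h8 x hx]

theorem Tr.seq {p : Routine a} {q : Routine b} {P : (ℕ → ℤ → ℤ) → Prop} (hp : Tr X Y Γ p A P)
    (hq : ∀ A', P A' → Tr X Y Γ q A' Q) : Tr X Y Γ (p.seq q) A Q := by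
  intro l hl s hs hΓ
  obtain ⟨m, s', h1, h2, h3, h4⟩ := hp l hl s hs hΓ
  obtain ⟨n, s'', h1', h2', h3', h4'⟩ := hq _ h3 l hl s' rfl
    (fun x hx => (h4 x (hx.trans_le hl)).trans (hΓ x hx))
  refine ⟨_, _, h1.seq h1', ?_, h3', fun x hx => (h4' x hx).trans (h4 x hx)⟩
  refine timeY_le (n := 2) 1 ?_ (by norm_num)
  have := pow_mul_le (X := X) (Y := Y) (show a ≤ a + b by omega)
  have := pow_mul_le (X := X) (Y := Y) (show b ≤ a + b by omega)
  omega

/-- The value is evaluated once and kept in a variable, so it remains available after the arrays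
from which it was computed have changed. -/
theorem Tr.bind {e : Code a} {f : Code 1 → Routine b} {z : ℤ} (he : Ev X A Γ e z)
    (hf : ∀ Δ x, Γ.Ext Δ → (∀ A', Ev X A' Δ x z) → Tr X Y Δ (f x) A Q) :
    Tr X Y Γ (Routine.bind e f) A Q := by
  intro l hl s hs hΓ
  obtain ⟨m, s', h1, h2, h3, h4, h5⟩ := he l hl s hs hΓ
  have hΔ : Γ.Ext ⟨l + 1, s'.var⟩ :=
    ⟨by simp; omega, fun x hx => (h5 x (hx.trans_le hl)).trans (hΓ x hx)⟩
  obtain ⟨n, s'', h1', h2', h3', h4'⟩ := hf _ (Code.var l) hΔ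
    (fun A' => h4 ▸ Ev.var (X := X) (A := A') (Γ := ⟨l + 1, s'.var⟩) (x := l) (by simp))
    (l + 1) le_rfl s' h3 (fun _ _ => rfl)
  refine ⟨_, _, h1.seq h1', ?_, h3', fun x hx => (h4' x (by omega)).trans (h5 x hx)⟩
  refine timeY_le (n := 2) 1 ?_ (by norm_num)
  have := pow_le_pow_mul (X := X) (Y := Y) (show a ≤ a + b by omega)
  have := pow_mul_le (X := X) (Y := Y) (show b ≤ a + b by omega)
  omega

theorem Tr.ifLt {e : Code a} {f : Code b} {p : Routine c} {q : Routine d} {y z : ℤ}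
    (he : Ev X A Γ e y) (hf : Ev X A Γ f z) (hp : y < z → Tr X Y Γ p A Q)
    (hq : ¬ y < z → Tr X Y Γ q A Q) : Tr X Y Γ (Routine.ifLt e f p q) A Q := by
  intro l hl s hs hΓ
  obtain ⟨m, n, s', s'', h1, h2, h3, h4, h5, h6, h7, h8⟩ := he.two hf hl hs hΓ
  have hΓ' : Γ.Fits s'' := fun x hx => (h8 x (hx.trans_le hl)).trans (hΓ x hx)
  have hab := pow_le_pow_mul (X := X) (Y := Y) (show a + b ≤ a + b + c + d by omega)
  have h1ab := one_le_pow_mul (X := X) (Y := Y) (a + b + c + d)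
  by_cases hyz : y < z
  · obtain ⟨n', s3, k1, k2, k3, k4⟩ := hp hyz l hl s'' h5 hΓ'
    refine ⟨_, _, h1.seq (h2.seq (Exec.ite_true ?_ k1)), ?_, k3, ?_⟩
    · simp [AExp.eval, h6, h7, hyz]
    · refine timeY_le (n := 7) 3 ?_ (by norm_num)
      have := pow_mul_le (X := X) (Y := Y) (show c ≤ a + b + c + d by omega)
      simp [AExp.cost]; omega
    · intro x hx; rw [k4 x hx, h8 x hx]
  · obtain ⟨n', s3, k1, k2, k3, k4⟩ := hq hyz l hl s'' h5 hΓ'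
    refine ⟨_, _, h1.seq (h2.seq (Exec.ite_false ?_ k1)), ?_, k3, ?_⟩
    · simp [AExp.eval, h6, h7]; omega
    · refine timeY_le (n := 7) 3 ?_ (by norm_num)
      have := pow_mul_le (X := X) (Y := Y) (show d ≤ a + b + c + d by omega)
      simp [AExp.cost]; omega
    · intro x hx; rw [k4 x hx, h8 x hx]

/-- The body has its own parameter `Y'`: the common source of the rule for at most X passes, where
`Y' = Y`, and of the rule for at most Y passes, where `Y' = 0`. -/
theorem exec_forTo {Y' : ℕ} {n : Code a} {f : Code 1 → Routine b} {N : ℕ}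
    (I : ℕ → (ℕ → ℤ → ℤ) → Prop) (hn : Ev X A Γ n N) (h0 : I 0 A)
    (hf : ∀ Δ x m A', Γ.Ext Δ → m < N → (∀ B, Ev X B Δ x (m : ℤ)) → I m A' →
      Tr X Y' Δ (f x) A' (I (m + 1)))
    {l : ℕ} (hl : l ≥ Γ.size) {s : State} (hs : s.arr = A) (hΓ : Γ.Fits s) :
    ∃ t s', Exec (Routine.forTo n f l) s t s' ∧
      t ≤ X ^ a + N * (X ^ b * (Y' + 1) + 8) + 6 ∧ I N s'.arr ∧ ∀ x < l, s'.var x = s.var x := by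
  obtain ⟨n1, s', h1, h2, h3, h4, h5⟩ := hn l hl s hs hΓ
  obtain ⟨n3, s3, k1, k2, k3⟩ := Exec.loop_of_count (e := .sub (.var l) (.var (l + 1)))
    (p := .seq (f (.var (l + 1)) (l + 2)) (.assign (l + 1) (.add (.var (l + 1)) (.const 1))))
    (t := X ^ b * (Y' + 1) + 4)
    (fun m s3 => I m s3.arr ∧ s3.var l = N ∧ s3.var (l + 1) = m ∧ ∀ x < l, s3.var x = s.var x) N
    (by
      rintro s3 ⟨-, e1, e2, -⟩
      simp [AExp.eval, e1, e2])
    (by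
      rintro m hm s3 ⟨e0, e1, e2, e3⟩
      refine ⟨by simp [AExp.eval, e1, e2, hm], ?_⟩
      have hΔ : Γ.Ext ⟨l + 2, s3.var⟩ :=
        ⟨by simp; omega, fun x hx => (e3 x (hx.trans_le hl)).trans (hΓ x hx)⟩
      have hx := fun B => Ev.var (X := X) (A := B) (Γ := ⟨l + 2, s3.var⟩) (x := l + 1) (by simp)
      simp only [e2] at hx
      obtain ⟨n4, s4, j1, j2, j3, j4⟩ := hf _ _ m _ hΔ hm hx e0 (l + 2) le_rfl s3 rfl
        (fun _ _ => rfl)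
      refine ⟨_, _, j1.seq (Exec.assign _ _ _), ?_, j3, ?_, ?_, ?_⟩
      · simp [AExp.cost]; omega
      · simp [State.setVar, j4, e1]
      · simp [State.setVar, AExp.eval, j4, e2]
      · intro x hx
        have h1 : x ≠ l + 1 := by omega
        simp [State.setVar, h1, j4 x (by omega), e3 x hx])
    (s'.setVar (l + 1) 0)
    (by
      refine ⟨by simpa [State.setVar, h3] using h0, by simp [State.setVar, h4],
        by simp [State.setVar], ?_⟩
      intro x hx
      have h2 : x ≠ l + 1 := by omega
      simp [State.setVar, h2, h5 x hx])
  refine ⟨_, s3, h1.seq ((Exec.assign _ _ _).seq k1), ?_, k3.1, k3.2.2.2⟩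
  have e4 : N * (1 + 1 + 1 + 1 + (X ^ b * (Y' + 1) + 4)) = N * (X ^ b * (Y' + 1) + 8) := by ring
  simp only [AExp.cost] at k2 ⊢
  omega

theorem Tr.forTo {n : Code a} {f : Code 1 → Routine b} {N : ℕ} (I : ℕ → (ℕ → ℤ → ℤ) → Prop)
    (hN : N ≤ X) (hn : Ev X A Γ n N) (h0 : I 0 A)
    (hf : ∀ Δ x m A', Γ.Ext Δ → m < N → (∀ B, Ev X B Δ x (m : ℤ)) → I m A' →
      Tr X Y Δ (f x) A' (I (m + 1))) : Tr X Y Γ (Routine.forTo n f) A (I N) := by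
  intro l hl s hs hΓ
  obtain ⟨t, s', h1, h2, h3, h4⟩ := exec_forTo I hn h0 hf hl hs hΓ
  refine ⟨t, s', h1, timeY_le (p := a + b + 1) (n := 16) 4 (h2.trans ?_) (by norm_num), h3, h4⟩
  have e1 : N * (X ^ b * (Y + 1) + 8) ≤ X ^ (a + b + 1) * (Y + 1) * 9 := by
    calc N * (X ^ b * (Y + 1) + 8) ≤ X * (X ^ b * (Y + 1) * 9) := by
          apply Nat.mul_le_mul hN
          have := one_le_pow_mul (X := X) (Y := Y) b
          omega
      _ = X ^ (b + 1) * (Y + 1) * 9 := by ring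
      _ ≤ _ := Nat.mul_le_mul_right _ (pow_mul_le (by omega))
  have e2 := pow_le_pow_mul (X := X) (Y := Y) (show a ≤ a + b + 1 by omega)
  have e3 := one_le_pow_mul (X := X) (Y := Y) (a + b + 1)
  omega

/-- The body must not use the factor `Y + 1` itself. So loops over bits cannot be nested, and the
time stays linear in Y. -/
theorem Tr.forTo_long {n : Code a} {f : Code 1 → Routine b} {N : ℕ} (I : ℕ → (ℕ → ℤ → ℤ) → Prop)
    (hN : N ≤ Y) (hn : Ev X A Γ n N) (h0 : I 0 A)
    (hf : ∀ Δ x m A', Γ.Ext Δ → m < N → (∀ B, Ev X B Δ x (m : ℤ)) → I m A' →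
      Tr X 0 Δ (f x) A' (I (m + 1))) : Tr X Y Γ (Routine.forTo n f) A (I N) := by
  intro l hl s hs hΓ
  obtain ⟨t, s', h1, h2, h3, h4⟩ := exec_forTo I hn h0 hf hl hs hΓ
  refine ⟨t, s', h1, (timeY_le (p := a + b) (n := 16) 4 (h2.trans ?_) (by norm_num)).trans
    (pow_mul_le (by omega)), h3, h4⟩
  have e1 : N * (X ^ b * (0 + 1) + 8) ≤ X ^ (a + b) * (Y + 1) * 9 := by
    calc N * (X ^ b * (0 + 1) + 8) ≤ (Y + 1) * (X ^ b * 9) := by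
          apply Nat.mul_le_mul (by omega)
          have := one_le_pow_X (X := X) b
          omega
      _ = X ^ b * (Y + 1) * 9 := by ring
      _ ≤ _ := Nat.mul_le_mul_right _ (pow_mul_le (by omega))
  have e2 := pow_le_pow_mul (X := X) (Y := Y) (show a ≤ a + b by omega)
  have e3 := one_le_pow_mul (X := X) (Y := Y) (a + b)
  omega

theorem Tr.powersOfTwo {i : ℕ} {e : Code a} {f : Code 1 → Routine b} {N : ℕ} (hN : N.size ≤ Y)
    (he : Ev X A Γ e N)
    (hf : ∀ Δ x A', Γ.Ext Δ → (∀ B, Ev X B Δ x (N.size : ℤ)) → (∀ j ≠ i, A' j = A j) →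
      (∀ m < N.size, A' i m = 2 ^ m) → Tr X Y Δ (f x) A' Q) :
    Tr X Y Γ (Routine.powersOfTwo i e f) A Q := by
  intro l hl s hs hΓ
  obtain ⟨n1, s', h1, h2, h3, h4, h5⟩ := he l hl s hs hΓ
  obtain ⟨n3, s3, k1, k2, k3⟩ := Exec.loop_of_count
    (e := .add (.sub (.var l) (.var (l + 1))) (.const 1))
    (p := .seq (.write i (.var (l + 2)) (.var (l + 1)))
        (.seq (.assign (l + 1) (.add (.var (l + 1)) (.var (l + 1))))
          (.assign (l + 2) (.add (.var (l + 2)) (.const 1)))))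
    (t := 11)
    (fun m s3 => ((∀ j ≠ i, s3.arr j = A j) ∧ ∀ m' < m, s3.arr i m' = 2 ^ m') ∧ s3.var l = N ∧
      s3.var (l + 1) = 2 ^ m ∧ s3.var (l + 2) = m ∧ ∀ x < l, s3.var x = s.var x) N.size
    (by
      rintro s3 ⟨-, e1, e2, -, -⟩
      have : (N : ℤ) < 2 ^ N.size := by exact_mod_cast Nat.lt_size_self N
      simp [AExp.eval, e1, e2]; omega)
    -- The test `0 < N - 2 ^ m + 1` says 2^m ≤ N, which is m < `N.size`; this fixes the number of
    -- passes.
    (by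
      rintro m hm s3 ⟨⟨e0, e0'⟩, e1, e2, e3, e4⟩
      have : (2 : ℤ) ^ m ≤ N := by exact_mod_cast Nat.lt_size.1 hm
      refine ⟨by simp [AExp.eval, e1, e2]; omega, ?_⟩
      refine ⟨_, _, (Exec.write _ _ _ _).seq ((Exec.assign _ _ _).seq (Exec.assign _ _ _)),
        ?_, ⟨?_, ?_⟩, ?_, ?_, ?_, ?_⟩
      · simp [AExp.cost]
      · intro j hj
        simp [State.setVar, State.setArr, hj, e0 j hj]
      · intro m' hm'
        rcases Nat.lt_succ_iff_lt_or_eq.1 hm' with h | h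
        · have : (m' : ℤ) ≠ m := by omega
          simp [State.setVar, State.setArr, AExp.eval, e3, this, e0' m' h]
        · simp [State.setVar, State.setArr, AExp.eval, e3, e2, h]
      · simp [State.setVar, State.setArr, e1]
      · simp [State.setVar, State.setArr, AExp.eval, e2]; ring
      · simp [State.setVar, State.setArr, AExp.eval, e3]
      · intro x hx
        have h1 : x ≠ l + 1 := by omega
        have h2 : x ≠ l + 2 := by omega
        simp [State.setVar, State.setArr, h1, h2, e4 x hx])
    ((s'.setVar (l + 1) 1).setVar (l + 2) 0)
    (by
      refine ⟨⟨fun j hj => by simp [State.setVar, h3], by simp⟩, by simp [State.setVar, h4],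
        by simp [State.setVar], by simp [State.setVar], ?_⟩
      intro x hx
      have h1 : x ≠ l + 1 := by omega
      have h2 : x ≠ l + 2 := by omega
      simp [State.setVar, h1, h2, h5 x hx])
  obtain ⟨⟨e0, e0'⟩, e1, e2, e3, e4⟩ := k3
  have hΔ : Γ.Ext ⟨l + 3, s3.var⟩ :=
    ⟨by simp; omega, fun x hx => (e4 x (hx.trans_le hl)).trans (hΓ x hx)⟩
  have hx := fun B => Ev.var (X := X) (A := B) (Γ := ⟨l + 3, s3.var⟩) (x := l + 2) (by simp)
  simp only [e3] at hx
  obtain ⟨n4, s4, j1, j2, j3, j4⟩ := hf _ _ _ hΔ hx e0 e0' (l + 3) le_rfl s3 rfl (fun _ _ => rfl)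
  refine ⟨_, s4, h1.seq ((Exec.assign _ _ _).seq ((Exec.assign _ _ _).seq (k1.seq j1))), ?_, j3,
    fun x hx => (j4 x (by omega)).trans (e4 x hx)⟩
  refine timeY_le (n := 32) 5 ?_ (by norm_num)
  have e1 := pow_le_pow_mul (X := X) (Y := Y) (show a ≤ a + b by omega)
  have e2 := pow_mul_le (X := X) (Y := Y) (show b ≤ a + b by omega)
  have e3 := one_le_pow_mul (X := X) (Y := Y) (a + b)
  have e5 : Y + 1 ≤ X ^ (a + b) * (Y + 1) := Nat.le_mul_of_pos_left _ (one_le_pow_X _)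
  simp only [AExp.cost] at k2 ⊢
  omega

end Rules

end RAM

/-! ### Derived arithmetic: products, powers, division, minimisation, filling of arrays -/

namespace RAM

/-- The first index below `N` at which `F` is minimal (and `0` if `N = 0`). -/
def firstMin (F : ℕ → ℤ) : ℕ → ℕ
  | 0 => 0
  | m + 1 => if F m < F (firstMin F m) then m else firstMin F m

theorem firstMin_spec (F : ℕ → ℤ) {N : ℕ} (hN : 0 < N) :
    firstMin F N < N ∧ ∀ m < N, F (firstMin F N) ≤ F m := by
  induction N, hN using Nat.le_induction with
  | base => simp [firstMin]
  | succ N hN ih =>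
    rw [firstMin]
    split_ifs with h
    · refine ⟨by omega, fun m hm => ?_⟩
      rcases Nat.lt_succ_iff_lt_or_eq.1 hm with h' | rfl
      · exact h.le.trans (ih.2 m h')
      · exact le_rfl
    · refine ⟨by omega, fun m hm => ?_⟩
      rcases Nat.lt_succ_iff_lt_or_eq.1 hm with h' | rfl
      · exact ih.2 m h'
      · exact not_lt.1 h

theorem firstMin_lt_or (F : ℕ → ℤ) (N : ℕ) : firstMin F N < N ∨ firstMin F N = 0 := by
  rcases N.eq_zero_or_pos with rfl | h
  · exact Or.inr rfl
  · exact Or.inl (firstMin_spec F h).1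

variable {X Y : ℕ} {A : ℕ → ℤ → ℤ} {Γ Δ : Ctx} {a b c d : ℕ}

namespace Code

def sum (n : Code a) (f : Code 1 → Code c) := fold n (num 0) fun x y => y.add (f x)

def mul (e : Code a) (f : Code b) := sum e fun _ => f

def pow (e : Code a) (n : Code b) := fold n (num 1) fun _ y => mul e y

def div (e : Code a) (f : Code b) :=
  fold e (num 0) fun _ y => ifLt e (mul (y.add (num 1)) f) y (y.add (num 1))

def mod (e : Code a) (f : Code b) := sub e (mul (div e f) f)

def abs (e : Code a) := ifLt e (num 0) ((num 0).sub e) e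

def argmin (n : Code a) (f : Code 1 → Code c) := fold n (num 0) fun x y => ifLt (f x) (f y) x y

/-- Position `m * n + u` of array `i`, where `m`, `n` and `u` are the values of `e`, `n` and `f`. -/
def cell (i : ℕ) (e : Code a) (n : Code b) (f : Code c) := read i (add (mul e n) f)

end Code

namespace Routine

/-- Write the values of `e` at `0, …, n - 1` into array `i`, starting at position `b`. -/
def fill (i : ℕ) (b : Code a) (n : Code c) (e : Code 1 → Code d) :=
  forTo n fun u => write i (b.add u) (e u)

end Routine

variable [hX : X.AtLeastTwo]

omit hX in
theorem Ev.congr {e : Code c} {y z : ℤ} (h : Ev X A Γ e y) (hyz : y = z) : Ev X A Γ e z := hyz ▸ h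

theorem Ev.nat (n : ℕ) : Ev X A Γ (Code.num n) (n : ℤ) := Ev.num _

theorem Ev.sum {n : Code a} {f : Code 1 → Code c} {N : ℕ} (F : ℕ → ℤ) (hN : N ≤ X)
    (hn : Ev X A Γ n N)
    (hf : ∀ Δ x m, Γ.Ext Δ → m < N → Ev X A Δ x (m : ℤ) → Ev X A Δ (f x) (F m)) :
    Ev X A Γ (Code.sum n f) (∑ m ∈ Finset.range N, F m) := by
  refine Ev.fold (fun m => ∑ j ∈ Finset.range m, F j) hN hn (by simpa using Ev.num 0) ?_
  intro Δ x y m hΔ hm hx hy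
  rw [Finset.sum_range_succ]
  exact hy.add (hf Δ x m hΔ hm hx)

/-- Repeated addition: only the first factor is a loop length and has to be at most X. The second
one may be as large as the vertex counts, or negative. -/
theorem Ev.mul {e : Code a} {f : Code b} {m : ℕ} {z : ℤ} (hm : m ≤ X) (he : Ev X A Γ e m)
    (hf : Ev X A Γ f z) : Ev X A Γ (Code.mul e f) (m * z) :=
  (Ev.sum (fun _ => z) hm he fun _ _ _ hΔ _ _ => hf.mono hΔ).congr (by simp)

theorem Ev.pow {e : Code a} {n : Code b} {m N : ℕ} (hm : m ≤ X) (hN : N ≤ X) (he : Ev X A Γ e m)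
    (hn : Ev X A Γ n N) : Ev X A Γ (Code.pow e n) ((m ^ N : ℕ) : ℤ) := by
  refine Ev.fold (fun j => ((m ^ j : ℕ) : ℤ)) hN hn (by simpa using Ev.num 1) ?_
  intro Δ x y j hΔ hj hx hy
  exact ((he.mono hΔ).mul hm hy).congr (by push_cast; ring)

/-- After j passes the accumulator is min(j, m / n): it grows while its successor times n does not
exceed m. The strict bound `m < X` leaves room for the successor as a factor. -/
theorem Ev.div {e : Code a} {f : Code b} {m n : ℕ} (hm : m < X) (hn : 0 < n) (he : Ev X A Γ e m)
    (hf : Ev X A Γ f n) : Ev X A Γ (Code.div e f) ((m / n : ℕ) : ℤ) := by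
  have h := Ev.fold (X := X) (A := A) (Γ := Γ) (n := e) (i := Code.num 0)
    (f := fun _ y => Code.ifLt e (Code.mul (y.add (.num 1)) f) y (y.add (.num 1)))
    (fun j => ((min j (m / n) : ℕ) : ℤ)) hm.le he (by simpa using Ev.num 0) ?_
  · exact h.congr (by rw [min_eq_right (Nat.div_le_self m n)])
  intro Δ x y j hΔ hj hx hy
  have hy1 : Ev X A Δ (y.add (.num 1)) ((min j (m / n) + 1 : ℕ) : ℤ) :=
    (hy.add (Ev.num 1)).congr (by push_cast; ring)
  refine (Ev.ifLt (he.mono hΔ) (hy1.mul (by omega) (hf.mono hΔ)) (fun _ => hy)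
    (fun _ => hy1)).congr ?_
  have h1 : ((m : ℤ) < ((min j (m / n) + 1 : ℕ) : ℤ) * n) ↔ ¬ min j (m / n) + 1 ≤ m / n := by
    rw [Nat.le_div_iff_mul_le hn]
    push_cast
    rw [not_le]
    exact_mod_cast Iff.rfl
  rw [if_congr h1 rfl rfl]
  split_ifs with h2
  · congr 1; omega
  · congr 1; omega

theorem Ev.mod {e : Code a} {f : Code b} {m n : ℕ} (hm : m < X) (hn : 0 < n) (he : Ev X A Γ e m)
    (hf : Ev X A Γ f n) : Ev X A Γ (Code.mod e f) ((m % n : ℕ) : ℤ) := by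
  refine (he.sub ((he.div hm hn hf).mul ((Nat.div_le_self m n).trans hm.le) hf)).congr ?_
  have := Nat.div_add_mod m n
  zify at this ⊢
  linarith

theorem Ev.abs {e : Code a} {z : ℤ} (he : Ev X A Γ e z) : Ev X A Γ (Code.abs e) |z| := by
  refine (Ev.ifLt he (Ev.num 0) (fun _ => (Ev.num 0).sub he) (fun _ => he)).congr ?_
  split_ifs with h
  · rw [abs_of_neg h]; ring
  · rw [abs_of_nonneg (not_lt.1 h)]

theorem Ev.argmin {n : Code a} {f : Code 1 → Code c} {N : ℕ} (F : ℕ → ℤ) (hN : N ≤ X)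
    (hn : Ev X A Γ n N)
    (hf : ∀ Δ x m, Γ.Ext Δ → m < N → Ev X A Δ x (m : ℤ) → Ev X A Δ (f x) (F m)) :
    Ev X A Γ (Code.argmin n f) (firstMin F N : ℤ) := by
  refine Ev.fold (fun m => (firstMin F m : ℤ)) hN hn (by simpa [firstMin] using Ev.num 0) ?_
  intro Δ x y m hΔ hm hx hy
  refine (Ev.ifLt (hf Δ x m hΔ hm hx) (hf Δ y _ hΔ ?_ hy) (fun _ => hx) (fun _ => hy)).congr ?_
  · rcases firstMin_lt_or F m with h | h <;> omega
  · rw [firstMin]; split_ifs <;> rfl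

theorem Ev.cell {e : Code a} {n : Code b} {f : Code c} {m : ℕ} {N u : ℤ} (i : ℕ) (hm : m ≤ X)
    (he : Ev X A Γ e m) (hn : Ev X A Γ n N) (hf : Ev X A Γ f u) :
    Ev X A Γ (Code.cell i e n f) (A i (m * N + u)) :=
  ((he.mul hm hn).add hf).read i

/-- The arrays `A'` arise from `A` by writing `F 0, …, F (N - 1)` into array `i` from position `b`
on. -/
def Filled (i : ℕ) (b : ℤ) (N : ℕ) (F : ℕ → ℤ) (A A' : ℕ → ℤ → ℤ) : Prop :=
  (∀ j ≠ i, A' j = A j) ∧ (∀ u < N, A' i (b + u) = F u) ∧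
    ∀ z, (z < b ∨ b + N ≤ z) → A' i z = A i z

theorem Tr.fill {e : Code 1 → Code d} {f : Code a} {n : Code c} {b : ℤ} {N : ℕ} (F : ℕ → ℤ) (i : ℕ)
    (hN : N ≤ X) (hb : ∀ A', (∀ j ≠ i, A' j = A j) → Ev X A' Γ f b) (hn : Ev X A Γ n N)
    (he : ∀ Δ x m A', Γ.Ext Δ → m < N → (∀ j ≠ i, A' j = A j) → Ev X A' Δ x (m : ℤ) →
      Ev X A' Δ (e x) (F m)) :
    Tr X Y Γ (Routine.fill i f n e) A (Filled i b N F A) := by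
  refine Tr.forTo (fun m => Filled i b m F A) hN hn ⟨fun _ _ => rfl, by simp, fun _ _ => rfl⟩ ?_
  rintro Δ x m A' hΔ hm hx ⟨h1, h2, h3⟩
  refine Tr.write i (((hb A' h1).mono hΔ).add (hx A')) (he Δ x m A' hΔ hm h1 (hx A')) ⟨?_, ?_, ?_⟩
  · intro j hj; simp [setArr, hj, h1 j hj]
  · intro u hu
    rcases Nat.lt_succ_iff_lt_or_eq.1 hu with h | rfl
    · have : (u : ℤ) ≠ m := by omega
      simp [setArr, this, h2 u h]
    · simp [setArr]
  · intro z hz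
    push_cast at hz
    have : z ≠ b + m := by omega
    simp only [setArr, Function.update_self, Function.update_of_ne this]
    exact h3 z (by omega)

end RAM

/-! ### Integer programs with block constraints and few linear forms -/

namespace BlockProgram

open Finset

/-- The `j`-th linear form. -/
def form (k T : ℕ) (B : ℕ → ℕ → ℕ → ℤ) (z : ℕ → ℕ → ℤ) (j : ℕ) : ℤ :=
  ∑ t ∈ range T, ∑ i ∈ range (k + 1), B j t i * z t i

/-- The objective: a linear function plus the distance of the linear forms from the target `r`. -/
def value (k T : ℕ) (B : ℕ → ℕ → ℕ → ℤ) (W : ℕ → ℕ → ℤ) (r : ℕ → ℤ) (z : ℕ → ℕ → ℤ) : ℤ :=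
  ∑ t ∈ range T, ∑ i ∈ range (k + 1), W t i * z t i + ∑ j ∈ range k, |form k T B z j - r j|

/-- The vector `z` is nonnegative with block sums `ν`. -/
def Feasible (k T : ℕ) (ν : ℕ → ℤ) (z : ℕ → ℕ → ℤ) : Prop :=
  ∀ t < T, (∀ i < k + 1, 0 ≤ z t i) ∧ ∑ i ∈ range (k + 1), z t i = ν t

/-- The vectors `z` and `w` agree on the entries that matter. -/
def Same (k T : ℕ) (z w : ℕ → ℕ → ℤ) : Prop := ∀ t < T, ∀ i < k + 1, z t i = w t i

variable {k T : ℕ} {B : ℕ → ℕ → ℕ → ℤ} {W : ℕ → ℕ → ℤ} {r r' : ℕ → ℤ} {z w : ℕ → ℕ → ℤ}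
  {ν : ℕ → ℤ}

theorem form_congr (h : Same k T z w) (j : ℕ) : form k T B z j = form k T B w j :=
  sum_congr rfl fun t ht => sum_congr rfl fun i hi => by
    rw [h t (mem_range.1 ht) i (mem_range.1 hi)]

theorem value_congr (h : Same k T z w) (hr : ∀ j < k, r j = r' j) :
    value k T B W r z = value k T B W r' w := by
  unfold value
  congr 1
  · exact sum_congr rfl fun t ht => sum_congr rfl fun i hi => by
      rw [h t (mem_range.1 ht) i (mem_range.1 hi)]
  · exact sum_congr rfl fun j hj => by rw [form_congr h, hr j (mem_range.1 hj)]

theorem Feasible.congr (hz : Feasible k T ν z) (h : Same k T w z) : Feasible k T ν w := by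
  intro t ht
  refine ⟨fun i hi => (h t ht i hi).symm ▸ (hz t ht).1 i hi, ?_⟩
  rw [← (hz t ht).2]
  exact sum_congr rfl fun i hi => h t ht i (mem_range.1 hi)

theorem form_add (z w : ℕ → ℕ → ℤ) (j : ℕ) :
    form k T B (fun t i => z t i + w t i) j = form k T B z j + form k T B w j := by
  simp only [form, mul_add, sum_add_distrib]

/-- The triangle inequality in each absolute value; the rest is linear. -/
theorem value_add_le (z w : ℕ → ℕ → ℤ) (r s : ℕ → ℤ) :
    value k T B W (fun j => r j + s j) (fun t i => z t i + w t i) ≤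
      value k T B W r z + value k T B W s w := by
  have h : ∑ j ∈ range k, |form k T B (fun t i => z t i + w t i) j - (r j + s j)| ≤
      ∑ j ∈ range k, |form k T B z j - r j| + ∑ j ∈ range k, |form k T B w j - s j| := by
    rw [← sum_add_distrib]
    refine sum_le_sum fun j _ => ?_
    rw [form_add, add_sub_add_comm]
    exact abs_add_le _ _
  simp only [value, mul_add, sum_add_distrib] at h ⊢
  linarith

/-- Half of a sequence, rounded such that all partial sums are rounded down. -/
def half (f : ℕ → ℤ) (i : ℕ) : ℤ := (∑ j ∈ range (i + 1), f j) / 2 - (∑ j ∈ range i, f j) / 2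

theorem sum_half (f : ℕ → ℤ) (n : ℕ) : ∑ i ∈ range n, half f i = (∑ i ∈ range n, f i) / 2 := by
  unfold half
  rw [sum_range_sub (fun i => (∑ j ∈ range i, f j) / 2)]
  simp

/-- A difference of the floors of S/2 and (S + f i)/2 is `f i / 2` rounded down or up, so the two
parts of the entry differ by at most 1. -/
theorem half_bounds {f : ℕ → ℤ} {i : ℕ} (h : 0 ≤ f i) :
    0 ≤ half f i ∧ half f i ≤ f i ∧ |half f i - (f i - half f i)| ≤ 1 := by
  unfold half
  rw [sum_range_succ, abs_le]
  omega

theorem abs_form_le (hB : ∀ j t i, |B j t i| ≤ 1) (h : ∀ t < T, ∀ i < k + 1, |z t i| ≤ 1) (j : ℕ) :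
    |form k T B z j| ≤ T * (k + 1) := by
  calc |form k T B z j| ≤ ∑ t ∈ range T, ∑ i ∈ range (k + 1), |B j t i * z t i| :=
        (abs_sum_le_sum_abs _ _).trans (sum_le_sum fun t _ => abs_sum_le_sum_abs _ _)
    _ ≤ ∑ t ∈ range T, ∑ i ∈ range (k + 1), 1 := by
        refine sum_le_sum fun t ht => sum_le_sum fun i hi => ?_
        rw [abs_mul]
        exact mul_le_one₀ (hB j t i) (abs_nonneg _) (h t (mem_range.1 ht) i (mem_range.1 hi))
    _ = T * (k + 1) := by simp

/-- Rounding the partial sums rather than the entries makes both halves meet the block sums exactly,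
while corresponding entries still differ by at most 1. Hence the forms of the two halves differ by
at most T(k+1). The residual form - r is halved as well, and each half of the target is chosen to
leave its half of the residual; twice such a target differs from r by at most T(k+1) + 1. -/
theorem exists_split (hB : ∀ j t i, |B j t i| ≤ 1) (r : ℕ → ℤ)
    (hz : Feasible k T (fun t => 2 * ν t) z) :
    ∃ (z₁ z₂ : ℕ → ℕ → ℤ) (r₁ r₂ : ℕ → ℤ), Feasible k T ν z₁ ∧ Feasible k T ν z₂ ∧
      (∀ j, 2 * |r₁ j| ≤ |r j| + (T * (k + 1) + 1)) ∧
      (∀ j, 2 * |r₂ j| ≤ |r j| + (T * (k + 1) + 1)) ∧ (∀ j, r₁ j + r₂ j = r j) ∧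
      value k T B W r₁ z₁ + value k T B W r₂ z₂ = value k T B W r z := by
  set z₁ : ℕ → ℕ → ℤ := fun t i => half (z t) i with hz₁
  set z₂ : ℕ → ℕ → ℤ := fun t i => z t i - z₁ t i with hz₂
  have hadd : (fun t i => z₁ t i + z₂ t i) = z := by ext t i; simp [hz₂]
  have hsum (j) : form k T B z₁ j + form k T B z₂ j = form k T B z j := by rw [← form_add, hadd]
  have hdiff (j) : |form k T B z₁ j - form k T B z₂ j| ≤ T * (k + 1) := by
    have : form k T B z₁ j - form k T B z₂ j = form k T B (fun t i => z₁ t i - z₂ t i) j := by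
      simp only [form, mul_sub, sum_sub_distrib]
    rw [this]
    exact abs_form_le hB (fun t ht i hi => (half_bounds ((hz t ht).1 i hi)).2.2) j
  -- Both `δ` and the rest of the residual have the sign of the residual or vanish, so their
  -- absolute values add up without loss.
  set δ : ℕ → ℤ := fun j => (form k T B z j - r j) / 2
  refine ⟨z₁, z₂, fun j => form k T B z₁ j - δ j,
    fun j => form k T B z₂ j - ((form k T B z j - r j) - δ j), ?_, ?_, ?_, ?_, ?_, ?_⟩
  · intro t ht
    refine ⟨fun i hi => (half_bounds ((hz t ht).1 i hi)).1, ?_⟩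
    simp only [hz₁, sum_half, (hz t ht).2]
    omega
  · intro t ht
    refine ⟨fun i hi => sub_nonneg.2 (half_bounds ((hz t ht).1 i hi)).2.1, ?_⟩
    simp only [hz₂, hz₁, sum_sub_distrib, sum_half, (hz t ht).2]
    omega
  · intro j
    have h1 := hsum j
    have h2 := abs_le.1 (hdiff j)
    rcases abs_cases (form k T B z₁ j - δ j) with h | h <;> rcases abs_cases (r j) with h' | h' <;>
      simp only [δ] at * <;> omega
  · intro j
    have h1 := hsum j
    have h2 := abs_le.1 (hdiff j)
    rcases abs_cases (form k T B z₂ j - ((form k T B z j - r j) - δ j)) with h | h <;>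
      rcases abs_cases (r j) with h' | h' <;> simp only [δ] at * <;> omega
  · intro j
    have h1 := hsum j
    simp only
    omega
  · have h1 : ∑ j ∈ range k, |form k T B z j - r j| =
        ∑ j ∈ range k, |form k T B z₁ j - (form k T B z₁ j - δ j)| +
        ∑ j ∈ range k, |form k T B z₂ j - (form k T B z₂ j - ((form k T B z j - r j) - δ j))| := by
      rw [← sum_add_distrib]
      refine sum_congr rfl fun j _ => ?_
      rw [sub_sub_cancel, sub_sub_cancel]
      simp only [δ]
      rcases abs_cases (form k T B z j - r j) with h | h <;>
      rcases abs_cases ((form k T B z j - r j) / 2) with h' | h' <;>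
      rcases abs_cases (form k T B z j - r j - (form k T B z j - r j) / 2) with h'' | h'' <;>
      omega
    have h2 : ∑ t ∈ range T, ∑ i ∈ range (k + 1), W t i * z t i =
        ∑ t ∈ range T, ∑ i ∈ range (k + 1), W t i * z₁ t i +
        ∑ t ∈ range T, ∑ i ∈ range (k + 1), W t i * z₂ t i := by
      conv_lhs => rw [← hadd]
      simp only [mul_add, sum_add_distrib]
    simp only [value]
    rw [h1, h2]
    ring

/-- The unit vector. -/
def unit (t₀ i₀ t i : ℕ) : ℤ := if t = t₀ ∧ i = i₀ then 1 else 0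

theorem sum_mul_unit (F : ℕ → ℕ → ℤ) {t₀ i₀ : ℕ} (ht : t₀ < T) (hi : i₀ < k + 1) :
    ∑ t ∈ range T, ∑ i ∈ range (k + 1), F t i * unit t₀ i₀ t i = F t₀ i₀ := by
  rw [sum_eq_single t₀, sum_eq_single i₀]
  · simp [unit]
  · intro i _ h; simp [unit, h]
  · intro h; exact absurd (mem_range.2 hi) h
  · intro t _ h; simp [unit, h]
  · intro h; exact absurd (mem_range.2 ht) h

theorem value_add_unit {t₀ i₀ : ℕ} (ht : t₀ < T) (hi : i₀ < k + 1) (z : ℕ → ℕ → ℤ) (r : ℕ → ℤ) :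
    value k T B W r (fun t i => z t i + unit t₀ i₀ t i) =
      value k T B W (fun j => r j - B j t₀ i₀) z + W t₀ i₀ := by
  have h1 (j) : form k T B (unit t₀ i₀) j = B j t₀ i₀ := sum_mul_unit _ ht hi
  simp only [value, form_add, h1, mul_add, sum_add_distrib, sum_mul_unit W ht hi]
  have h2 : ∀ j, form k T B z j + B j t₀ i₀ - r j = form k T B z j - (r j - B j t₀ i₀) :=
    fun j => by ring
  simp only [h2]
  ring

theorem Feasible.add {ν' : ℕ → ℤ} (hz : Feasible k T ν z) (hw : Feasible k T ν' w) :
    Feasible k T (fun t => ν t + ν' t) (fun t i => z t i + w t i) := fun t ht =>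
  ⟨fun i hi => add_nonneg ((hz t ht).1 i hi) ((hw t ht).1 i hi), by
    rw [sum_add_distrib, (hz t ht).2, (hw t ht).2]⟩

theorem feasible_unit {t₀ i₀ : ℕ} (hi : i₀ < k + 1) :
    Feasible k T (fun t => if t = t₀ then 1 else 0) (unit t₀ i₀) := by
  intro t _
  refine ⟨fun i _ => by unfold unit; positivity, ?_⟩
  by_cases h : t = t₀ <;> simp [unit, h]
  omega

/-- For each target `dec p`, the vector `Z p` is feasible, and it is optimal if the target has no
coordinate greater than `ρ`. -/
def IsTable (k T : ℕ) (B : ℕ → ℕ → ℕ → ℤ) (W : ℕ → ℕ → ℤ) (M : ℕ) (dec : ℕ → ℕ → ℤ) (ν : ℕ → ℤ)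
    (ρ : ℤ) (Z : ℕ → ℕ → ℕ → ℤ) : Prop :=
  ∀ p < M, Feasible k T ν (Z p) ∧ ((∀ j < k, |dec p j| ≤ ρ) →
    ∀ z, Feasible k T ν z → value k T B W (dec p) (Z p) ≤ value k T B W (dec p) z)

/-- For each target `dec p`, the vector `Z p` is the best of the vectors `C 0, …, C (N - 1)`. -/
def IsBest (k T : ℕ) (B : ℕ → ℕ → ℕ → ℤ) (W : ℕ → ℕ → ℤ) (M : ℕ) (dec : ℕ → ℕ → ℤ) (N : ℕ)
    (C : ℕ → ℕ → ℕ → ℤ) (Z : ℕ → ℕ → ℕ → ℤ) : Prop :=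
  ∀ p < M, ∃ c < N, Same k T (Z p) (C c) ∧
    ∀ c' < N, value k T B W (dec p) (C c) ≤ value k T B W (dec p) (C c')

variable {M : ℕ} {dec : ℕ → ℕ → ℤ} {ρ R : ℤ} {Z Z' : ℕ → ℕ → ℕ → ℤ}

/-- With block sums zero, the zero vector is the only feasible one. -/
theorem isTable_zero : IsTable k T B W M dec (fun _ => 0) ρ (fun _ _ _ => 0) := by
  intro p _
  refine ⟨fun t _ => ⟨fun _ _ => le_rfl, by simp⟩, fun _ z hz => (value_congr ?_ ?_).le⟩
  · intro t ht i hi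
    exact ((sum_eq_zero_iff_of_nonneg fun i hi => (hz t ht).1 i (mem_range.1 hi)).1 (hz t ht).2 i
      (mem_range.2 hi)).symm
  · exact fun _ _ => rfl

theorem IsTable.congr (h : IsTable k T B W M dec ν ρ Z) (hZ : ∀ p < M, Same k T (Z' p) (Z p)) :
    IsTable k T B W M dec ν ρ Z' := fun p hp =>
  ⟨(h p hp).1.congr (hZ p hp), fun hr z hz =>
    (value_congr (hZ p hp) fun _ _ => rfl).trans_le ((h p hp).2 hr z hz)⟩

theorem IsTable.congr_sums {ν' : ℕ → ℤ} (h : IsTable k T B W M dec ν ρ Z)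
    (hν : ∀ t < T, ν t = ν' t) : IsTable k T B W M dec ν' ρ Z := by
  have H : ∀ z, Feasible k T ν z ↔ Feasible k T ν' z := fun z =>
    forall₂_congr fun t ht => by rw [hν t ht]
  intro p hp
  simpa only [H] using h p hp

/-- Split an arbitrary competitor and its target. The two smaller targets lie within radius `ρ`,
where the old table is optimal, and by subadditivity the sum of the two old entries is at least as
good as the competitor. That sum is candidate `p₁ * M + p₂`, and the new entry is the best
candidate. -/
theorem IsTable.double (hB : ∀ j t i, |B j t i| ≤ 1)
    (hdec : ∀ r : ℕ → ℤ, (∀ j < k, |r j| ≤ R) → ∃ p < M, ∀ j < k, dec p j = r j)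
    (hρ : ρ ≤ R) (hR : R + (T * (k + 1) + 1) ≤ 2 * ρ) (h : IsTable k T B W M dec ν ρ Z)
    (hZ' : IsBest k T B W M dec (M * M) (fun c t i => Z (c / M) t i + Z (c % M) t i) Z') :
    IsTable k T B W M dec (fun t => 2 * ν t) R Z' := by
  intro p hp
  have hM : 0 < M := by omega
  obtain ⟨c, hc, hs, hmin⟩ := hZ' p hp
  refine ⟨?_, fun hr z hz => ?_⟩
  · refine Feasible.congr ?_ hs
    simp only [two_mul]
    exact (h _ (Nat.div_lt_of_lt_mul hc)).1.add (h _ (Nat.mod_lt _ hM)).1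
  · obtain ⟨z₁, z₂, r₁, r₂, hz₁, hz₂, hr₁, hr₂, hrr, hval⟩ := exists_split (W := W) hB (dec p) hz
    have hr₁' : ∀ j < k, |r₁ j| ≤ ρ := fun j hj => by have := hr₁ j; have := hr j hj; omega
    have hr₂' : ∀ j < k, |r₂ j| ≤ ρ := fun j hj => by have := hr₂ j; have := hr j hj; omega
    obtain ⟨p₁, hp₁, e₁⟩ := hdec r₁ fun j hj => (hr₁' j hj).trans hρ
    obtain ⟨p₂, hp₂, e₂⟩ := hdec r₂ fun j hj => (hr₂' j hj).trans hρ
    have hc' : p₁ * M + p₂ < M * M := by nlinarith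
    have hdiv : (p₁ * M + p₂) / M = p₁ := by
      rw [Nat.add_comm, Nat.add_mul_div_right _ _ hM, Nat.div_eq_of_lt hp₂, zero_add]
    have hmod : (p₁ * M + p₂) % M = p₂ := by
      rw [Nat.add_comm, Nat.add_mul_mod_self_right, Nat.mod_eq_of_lt hp₂]
    calc value k T B W (dec p) (Z' p) = _ := value_congr hs fun _ _ => rfl
      _ ≤ _ := hmin _ hc'
      _ = value k T B W (fun j => r₁ j + r₂ j) (fun t i => Z p₁ t i + Z p₂ t i) := by
          beta_reduce
          rw [hdiv, hmod]
          exact value_congr (fun _ _ _ _ => rfl) fun j _ => (hrr j).symm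
      _ ≤ value k T B W r₁ (Z p₁) + value k T B W r₂ (Z p₂) := value_add_le _ _ _ _
      _ ≤ value k T B W r₁ z₁ + value k T B W r₂ z₂ := by
          refine add_le_add ?_ ?_
          · have := (h p₁ hp₁).2 (fun j hj => (e₁ j hj).symm ▸ hr₁' j hj) z₁ hz₁
            rwa [value_congr (fun _ _ _ _ => rfl) e₁, value_congr (fun _ _ _ _ => rfl) e₁] at this
          · have := (h p₂ hp₂).2 (fun j hj => (e₂ j hj).symm ▸ hr₂' j hj) z₂ hz₂
            rwa [value_congr (fun _ _ _ _ => rfl) e₂, value_congr (fun _ _ _ _ => rfl) e₂] at this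
      _ = _ := hval

/-- Removing one unit from block `t₀` of a competitor amounts to shifting the target by a column of
`B`, whose entries are at most 1 in absolute value. This is why the old table must be valid for
radius `ρ + 1`. -/
theorem IsTable.add_unit {t₀ : ℕ} (ht₀ : t₀ < T) (hB : ∀ j t i, |B j t i| ≤ 1)
    (hdec : ∀ r : ℕ → ℤ, (∀ j < k, |r j| ≤ R) → ∃ p < M, ∀ j < k, dec p j = r j)
    (hρ : ρ + 1 ≤ R) (hν : 0 ≤ ν t₀) (h : IsTable k T B W M dec ν (ρ + 1) Z)
    (hZ' : IsBest k T B W M dec (M * (k + 1))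
      (fun c t i => Z (c / (k + 1)) t i + unit t₀ (c % (k + 1)) t i) Z') :
    IsTable k T B W M dec (fun t => ν t + if t = t₀ then 1 else 0) ρ Z' := by
  intro p hp
  obtain ⟨c, hc, hs, hmin⟩ := hZ' p hp
  refine ⟨?_, fun hr z hz => ?_⟩
  · refine Feasible.congr ?_ hs
    exact (h _ (Nat.div_lt_of_lt_mul (by rwa [mul_comm]))).1.add
      (feasible_unit (Nat.mod_lt _ k.succ_pos))
  -- The sum of block `t₀` is now at least 1, so some entry of the competitor is positive and a unit
  -- can be removed there.
  · obtain ⟨i₀, hi₀, hpos⟩ : ∃ i < k + 1, 1 ≤ z t₀ i := by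
      by_contra! hcon
      have h1 := (hz t₀ ht₀).2
      have h2 : ∑ i ∈ range (k + 1), z t₀ i ≤ 0 :=
        sum_nonpos fun i hi => by have := hcon i (mem_range.1 hi); omega
      simp only [if_true] at h1
      omega
    set z₁ : ℕ → ℕ → ℤ := fun t i => z t i - unit t₀ i₀ t i with hz₁
    have hz₁z : (fun t i => z₁ t i + unit t₀ i₀ t i) = z := by ext t i; simp [hz₁]
    have hf : Feasible k T ν z₁ := by
      intro t ht
      refine ⟨fun i hi => ?_, ?_⟩
      · have := (hz t ht).1 i hi
        simp only [hz₁, unit]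
        split_ifs with hti
        · obtain ⟨rfl, rfl⟩ := hti; omega
        · omega
      · have h1 := (hz t ht).2
        have h2 := (feasible_unit (k := k) (T := T) (t₀ := t₀) hi₀ t ht).2
        simp only [hz₁, sum_sub_distrib] at h1 h2 ⊢
        omega
    have hr' : ∀ j < k, |dec p j - B j t₀ i₀| ≤ ρ + 1 := fun j hj =>
      (abs_sub _ _).trans (add_le_add (hr j hj) (hB _ _ _))
    obtain ⟨p₁, hp₁, e₁⟩ := hdec (fun j => dec p j - B j t₀ i₀) fun j hj => (hr' j hj).trans hρ
    have hc' : p₁ * (k + 1) + i₀ < M * (k + 1) := by nlinarith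
    have hdiv : (p₁ * (k + 1) + i₀) / (k + 1) = p₁ := by
      rw [Nat.add_comm, Nat.add_mul_div_right _ _ k.succ_pos, Nat.div_eq_of_lt hi₀, zero_add]
    have hmod : (p₁ * (k + 1) + i₀) % (k + 1) = i₀ := by
      rw [Nat.add_comm, Nat.add_mul_mod_self_right, Nat.mod_eq_of_lt hi₀]
    calc value k T B W (dec p) (Z' p) = _ := value_congr hs fun _ _ => rfl
      _ ≤ _ := hmin _ hc'
      _ = value k T B W (dec p) (fun t i => Z p₁ t i + unit t₀ i₀ t i) := by
          beta_reduce
          rw [hdiv, hmod]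
      _ = value k T B W (fun j => dec p j - B j t₀ i₀) (Z p₁) + W t₀ i₀ :=
          value_add_unit ht₀ hi₀ _ _
      _ ≤ value k T B W (fun j => dec p j - B j t₀ i₀) z₁ + W t₀ i₀ := by
          have := (h p₁ hp₁).2 (fun j hj => (e₁ j hj).symm ▸ hr' j hj) z₁ hf
          rw [value_congr (fun _ _ _ _ => rfl) e₁, value_congr (fun _ _ _ _ => rfl) e₁] at this
          linarith
      _ = value k T B W (dec p) z := by rw [← value_add_unit ht₀ hi₀, hz₁z]

/-- Serves the numbering both of the orders of the cover, to base k, and of the targets, to base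
`side k T`. -/
theorem exists_digits {b n : ℕ} (f : ℕ → ℕ) (hf : ∀ j < n, f j < b) :
    ∃ p < b ^ n, ∀ j < n, p / b ^ j % b = f j := by
  let g : Fin n → Fin b := fun j => ⟨f j, hf j j.2⟩
  refine ⟨finFunctionFinEquiv g, (finFunctionFinEquiv g).2, fun j hj => ?_⟩
  have h := congrArg (fun g : Fin n → Fin b => (g ⟨j, hj⟩ : ℕ))
    (finFunctionFinEquiv.symm_apply_apply g)
  simpa only [finFunctionFinEquiv, Equiv.ofRightInverseOfCardLE_symm_apply] using h

end BlockProgram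

/-! ### The program -/

namespace ImbalanceProgram

open RAM BlockProgram Finset

/-- The number of values of a coordinate of a target. -/
def side (k T : ℕ) : ℕ := 2 * (4 * ((T + 2) * k)) + 1

/-- The digits of `q` to base `k`. -/
def digit (k q j : ℕ) : ℕ := q / k ^ j % k

/-- The number of pairs of equal digits among the first `k` ones. -/
def collisions (k q : ℕ) : ℤ :=
  ∑ j ∈ range k, ∑ j' ∈ range k, if (j : ℤ) < j' then
    (if (digit k q j : ℤ) < digit k q j' then 0
      else if (digit k q j' : ℤ) < digit k q j then 0 else 1) else 0

/-- The order with number `q`: its digits if they are distinct, and the identity otherwise. -/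
def order (k q j : ℕ) : ℕ := if collisions k q < 1 then digit k q j else j

/-- The target with number `p`. -/
def target (k T p j : ℕ) : ℤ :=
  ((p / side k T ^ j % side k T : ℕ) : ℤ) - ((4 * ((T + 2) * k) : ℕ) : ℤ)

/-- The contribution of a vertex of type `t` in slot `i` to the `j`-th cover vertex. -/
def coefficient (A : ℕ → ℤ → ℤ) (k q j t i : ℕ) : ℤ :=
  if 0 < A 1 (t * k + order k q j) then (if (j : ℤ) < i then 1 else -1) else 0

/-- The imbalance at a vertex of type `t` in slot `i`. -/
def weight (A : ℕ → ℤ → ℤ) (k q t i : ℕ) : ℤ := |∑ j ∈ range k, coefficient A k q j t i|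

/-- The contribution of the cover to the `j`-th cover vertex. -/
def offset (A : ℕ → ℤ → ℤ) (k q j : ℕ) : ℤ :=
  ∑ j' ∈ range k, if 0 < A 0 (order k q j * k + order k q j') then
    (if (j : ℤ) < j' then 1 else -1) else 0

/-- The vector with number `p` in the list `F`. -/
def entry (k T : ℕ) (F : ℤ → ℤ) (p t i : ℕ) : ℤ :=
  F (p * (T * (k + 1) : ℕ) + (t * (k + 1 : ℕ) + i))

/-- The objective for the order with number `q`. -/
def cost (A : ℕ → ℤ → ℤ) (k T q : ℕ) (r : ℕ → ℤ) (z : ℕ → ℕ → ℤ) : ℤ :=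
  value k T (coefficient A k q) (weight A k q) r z

section Expressions

variable {a b c d e : ℕ}

def coverSize : Code 1 := .var 0

def typeCount : Code 1 := .var 1

def slotCount := coverSize.add (.num 1)

def vectorSize := typeCount.mul slotCount

def radiusCode := (Code.num 4).mul ((typeCount.add (.num 2)).mul coverSize)

def sideCode := ((Code.num 2).mul radiusCode).add (.num 1)

def tableSize := sideCode.pow coverSize

def digitCode (q : Code a) (j : Code b) := (q.div (coverSize.pow j)).mod coverSize

def collisionsCode (q : Code a) := Code.sum coverSize fun j => Code.sum coverSize fun j' =>
  Code.ifLt j j' (.ifLt (digitCode q j) (digitCode q j') (.num 0)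
    (.ifLt (digitCode q j') (digitCode q j) (.num 0) (.num 1))) (.num 0)

def orderCode (q : Code a) (j : Code b) :=
  Code.ifLt (collisionsCode q) (.num 1) (digitCode q j) j

def targetCode (p : Code a) (j : Code b) :=
  ((p.div (sideCode.pow j)).mod sideCode).sub radiusCode

/-- The code of a coefficient times the code `z`. -/
def termCode (q : Code a) (j : Code b) (t : Code c) (i : Code d) (z : Code e) :=
  Code.ifLt (.num 0) (.cell 1 t coverSize (orderCode q j))
    (.ifLt j i z ((Code.num 0).sub z)) (.num 0)

def weightCode (q : Code a) (t : Code b) (i : Code c) :=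
  (Code.sum coverSize fun j => termCode q j t i (.num 1)).abs

def offsetCode (q : Code a) (j : Code b) := Code.sum coverSize fun j' =>
  Code.ifLt (.num 0) (.cell 0 (orderCode q j) coverSize (orderCode q j'))
    (.ifLt j j' (.num 1) (.num (-1))) (.num 0)

def costCode (q : Code a) (r : Code 1 → Code b) (z : Code 1 → Code 1 → Code c) :=
  (Code.sum typeCount fun t => Code.sum slotCount fun i => (weightCode q t i).mul (z t i)).add
    (Code.sum coverSize fun j =>
      ((Code.sum typeCount fun t => Code.sum slotCount fun i => termCode q j t i (z t i)).sub
        (r j)).abs)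

def entryIndex (t : Code a) (i : Code b) := (t.mul slotCount).add i

def unitCode (u : Code a) (v : Code b) :=
  Code.ifLt u v (.num 0) (.ifLt v u (.num 0) (.num 1))

end Expressions

section Routines

variable {a b c d : ℕ}

/-- Replace every vector of the table by the best candidate for its target. -/
def improve (q : Code a) (n : Code b) (f : Code 1 → Code 1 → Code 1 → Code c)
    (g : Code 1 → Code 1 → Code d) :=
  (Routine.forTo tableSize fun p =>
    .bind (.argmin n fun x => costCode q (fun j => targetCode p j) (f x)) fun x =>
      .fill 8 (p.mul vectorSize) vectorSize fun u => g x u).seq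
  (.fill 7 (.num 0) (tableSize.mul vectorSize) fun u => .read 8 u)

/-- A candidate is a pair of table entries, encoded as quotient and remainder modulo the table size.
-/
def sumCode (x : Code a) (u : Code b) :=
  (Code.cell 7 (x.div tableSize) vectorSize u).add (.cell 7 (x.mod tableSize) vectorSize u)

def doubleTable (q : Code a) :=
  improve q (tableSize.mul tableSize) (fun x t i => sumCode x (entryIndex t i)) sumCode

/-- A candidate is a table entry together with a slot for the new vertex, encoded as quotient and
remainder modulo k + 1. -/
def addCode (t : Code c) (x : Code a) (u : Code b) :=
  (Code.cell 7 (x.div slotCount) vectorSize u).add (unitCode u (entryIndex t (x.mod slotCount)))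

def addToTable (q : Code a) (t₀ : Code c) :=
  improve q (tableSize.mul slotCount) (fun x t i => addCode t₀ x (entryIndex t i)) (addCode t₀)

/-- Process the bits with number `s`. -/
def stage (q : Code a) (n : Code b) (s : Code c) :=
  (doubleTable q).seq (.forTo typeCount fun t =>
    .ifLt (.read 9 t) (.read 5 ((n.sub (.num 1)).sub s)) .skip
      ((Routine.write 9 t ((Code.read 9 t).sub (.read 5 ((n.sub (.num 1)).sub s)))).seq
        (addToTable q t)))

/-- Find an optimal vector for the order with number `q`. -/
def solve (q : Code a) (n : Code b) :=
  (Routine.fill 7 (.num 0) (tableSize.mul vectorSize) fun _ => .num 0).seq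
  ((Routine.fill 9 (.num 0) typeCount fun t => .read 2 t).seq
  ((Routine.forTo n fun s => stage q n s).seq
  (.bind (.argmin tableSize fun p => costCode q (fun j => (Code.num 0).sub (offsetCode q j))
      fun t i => .cell 7 p vectorSize (entryIndex t i)) fun p =>
    .fill 6 (q.mul vectorSize) vectorSize fun u => .cell 7 p vectorSize u)))

/-- Array 5 holds the powers of two, array 6 a best vector for each order, array 7 the current
table, array 8 the table under construction, and array 9 the parts of the type counts that are not
yet processed. Arrays 3 and 4 receive the output. -/
def main :=
  Routine.powersOfTwo 5 (.sum typeCount fun t => .read 2 t) fun n =>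
    (Routine.forTo (coverSize.pow coverSize) fun q => solve q n).seq
    (.bind (.argmin (coverSize.pow coverSize) fun q =>
        costCode q (fun j => (Code.num 0).sub (offsetCode q j))
          fun t i => .cell 6 q vectorSize (entryIndex t i)) fun q =>
      (Routine.fill 3 (.num 0) coverSize fun j => orderCode q j).seq
      (.fill 4 (.num 0) vectorSize fun u => .cell 6 q vectorSize u))

end Routines

/-- The parameter `X` bounds the sizes of all the loops. -/
structure Bounds (X k T : ℕ) : Prop where
  pos : 1 ≤ k
  five : 5 ≤ X
  slots : k + 1 < X
  types : T + 2 ≤ X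
  vector : T * (k + 1) ≤ X
  side_le : side k T ≤ X
  table : side k T ^ k < X
  order_lt : k ^ k < X
  table_sq : side k T ^ k * side k T ^ k ≤ X
  table_slots : side k T ^ k * (k + 1) ≤ X
  table_vector : side k T ^ k * (T * (k + 1)) ≤ X

/-- The context knows the number of cover vertices and the number of types. -/
def Knows (Γ : Ctx) (k T : ℕ) : Prop := 2 ≤ Γ.size ∧ Γ.val 0 = k ∧ Γ.val 1 = T

theorem Knows.mono {Γ Δ : Ctx} {k T : ℕ} (h : Knows Γ k T) (hΔ : Γ.Ext Δ) : Knows Δ k T :=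
  ⟨h.1.trans hΔ.1, (hΔ.2 0 (by have := h.1; omega)).trans h.2.1,
    (hΔ.2 1 (by have := h.1; omega)).trans h.2.2⟩

theorem order_lt {k q j : ℕ} (hk : 1 ≤ k) (hj : j < k) : order k q j < k := by
  unfold order
  split_ifs
  · exact Nat.mod_lt _ hk
  · exact hj

theorem abs_coefficient_le (A : ℕ → ℤ → ℤ) (k q j t i : ℕ) : |coefficient A k q j t i| ≤ 1 := by
  unfold coefficient
  split_ifs <;> simp

theorem weight_le (A : ℕ → ℤ → ℤ) (k q t i : ℕ) : weight A k q t i ≤ k := by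
  refine (abs_sum_le_sum_abs _ _).trans ((sum_le_sum fun j _ =>
    abs_coefficient_le A k q j t i).trans ?_)
  simp

theorem abs_offset_le (A : ℕ → ℤ → ℤ) (k q j : ℕ) : |offset A k q j| ≤ k := by
  refine (abs_sum_le_sum_abs _ _).trans ((sum_le_sum (g := fun _ => 1) fun j' _ => ?_).trans ?_)
  · split_ifs <;> simp
  · simp

/-! ### Values of the expressions of the program -/

section Evaluation

variable {X : ℕ} [hX : X.AtLeastTwo] {A : ℕ → ℤ → ℤ} {Γ : Ctx} {k T : ℕ} {a b c d e : ℕ}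
  (hB : Bounds X k T) (hΓ : Knows Γ k T)
include hΓ

theorem ev_coverSize : Ev X A Γ coverSize k :=
  (Ev.var (by have := hΓ.1; omega)).congr hΓ.2.1

theorem ev_typeCount : Ev X A Γ typeCount T :=
  (Ev.var (by have := hΓ.1; omega)).congr hΓ.2.2

theorem ev_slotCount : Ev X A Γ slotCount ((k + 1 : ℕ) : ℤ) :=
  ((ev_coverSize hΓ).add (Ev.nat 1)).congr (by push_cast; ring)

include hB

theorem ev_vectorSize : Ev X A Γ vectorSize ((T * (k + 1) : ℕ) : ℤ) :=
  ((ev_typeCount hΓ).mul (by have := hB.types; omega) (ev_slotCount hΓ)).congr (by push_cast; ring)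

theorem ev_radius : Ev X A Γ radiusCode ((4 * ((T + 2) * k) : ℕ) : ℤ) := by
  have h1 : Ev X A Γ (typeCount.add (.num 2)) ((T + 2 : ℕ) : ℤ) :=
    ((ev_typeCount hΓ).add (Ev.nat 2)).congr (by push_cast; ring)
  refine (Ev.mul (m := 4) (by have := hB.five; omega) (Ev.nat 4)
    (h1.mul hB.types (ev_coverSize hΓ))).congr (by push_cast; ring)

theorem ev_side : Ev X A Γ sideCode (side k T : ℤ) :=
  ((Ev.mul (m := 2) (by have := hB.five; omega) (Ev.nat 2) (ev_radius hB hΓ)).add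
    (Ev.nat 1)).congr (by simp only [side]; push_cast; ring)

theorem ev_tableSize : Ev X A Γ tableSize ((side k T ^ k : ℕ) : ℤ) :=
  (ev_side hB hΓ).pow hB.side_le (by have := hB.slots; omega) (ev_coverSize hΓ)

theorem ev_digit {q : Code a} {j : Code b} {m n : ℕ} (hm : m < X) (hn : n < k)
    (hq : Ev X A Γ q m) (hj : Ev X A Γ j n) : Ev X A Γ (digitCode q j) (digit k m n : ℤ) := by
  have h := hB.slots
  exact Ev.mod ((Nat.div_le_self _ _).trans_lt hm) hB.pos (Ev.div hm (Nat.pow_pos hB.pos) hq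
    ((ev_coverSize hΓ).pow (by omega) (by omega) hj)) (ev_coverSize hΓ)

theorem ev_collisions {q : Code a} {m : ℕ} (hm : m < X) (hq : Ev X A Γ q m) :
    Ev X A Γ (collisionsCode q) (collisions k m) := by
  have h := hB.slots
  refine Ev.sum _ (by omega) (ev_coverSize hΓ) fun Δ x j hΔ hj hx => ?_
  refine Ev.sum _ (by omega) (ev_coverSize (hΓ.mono hΔ)) fun Θ y j' hΘ hj' hy => ?_
  have hΓ' := hΓ.mono (hΔ.trans hΘ)
  have hq' := hq.mono (hΔ.trans hΘ)
  have h1 := ev_digit hB hΓ' hm hj hq' (hx.mono hΘ)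
  have h2 := ev_digit hB hΓ' hm hj' hq' hy
  exact Ev.ifLt (hx.mono hΘ) hy (fun _ => Ev.ifLt h1 h2 (fun _ => Ev.num 0)
    fun _ => Ev.ifLt h2 h1 (fun _ => Ev.num 0) fun _ => Ev.num 1) fun _ => Ev.num 0

theorem ev_order {q : Code a} {j : Code b} {m n : ℕ} (hm : m < X) (hn : n < k)
    (hq : Ev X A Γ q m) (hj : Ev X A Γ j n) : Ev X A Γ (orderCode q j) (order k m n : ℤ) :=
  (Ev.ifLt (ev_collisions hB hΓ hm hq) (Ev.num 1) (fun _ => ev_digit hB hΓ hm hn hq hj)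
    fun _ => hj).congr (by unfold order; split_ifs <;> rfl)

theorem ev_target {p : Code a} {j : Code b} {m n : ℕ} (hm : m < X) (hn : n < k)
    (hp : Ev X A Γ p m) (hj : Ev X A Γ j n) : Ev X A Γ (targetCode p j) (target k T m n) := by
  have h := hB.slots
  have hs : 0 < side k T := by unfold side; omega
  exact (Ev.mod ((Nat.div_le_self _ _).trans_lt hm) hs (Ev.div hm (Nat.pow_pos hs) hp
    ((ev_side hB hΓ).pow hB.side_le (by omega) hj)) (ev_side hB hΓ)).sub (ev_radius hB hΓ)

theorem ev_term {q : Code a} {j : Code b} {t : Code c} {i : Code d} {z : Code e} {m n s o : ℕ}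
    {y : ℤ} (hm : m < X) (hn : n < k) (hs : s < T) (hq : Ev X A Γ q m) (hj : Ev X A Γ j n)
    (ht : Ev X A Γ t s) (hi : Ev X A Γ i o) (hz : Ev X A Γ z y) :
    Ev X A Γ (termCode q j t i z) (coefficient A k m n s o * y) := by
  have h := hB.types
  refine (Ev.ifLt (Ev.num 0) (Ev.cell 1 (by omega) ht (ev_coverSize hΓ)
    (ev_order hB hΓ hm hn hq hj)) (fun _ => Ev.ifLt hj hi (fun _ => hz)
      fun _ => (Ev.num 0).sub hz) fun _ => Ev.num 0).congr ?_
  unfold coefficient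
  split_ifs <;> simp

theorem ev_weight {q : Code a} {t : Code c} {i : Code d} {m s o : ℕ} (hm : m < X) (hs : s < T)
    (hq : Ev X A Γ q m) (ht : Ev X A Γ t s) (hi : Ev X A Γ i o) :
    Ev X A Γ (weightCode q t i) (weight A k m s o) := by
  have h := hB.slots
  refine Ev.abs (Ev.sum _ (by omega) (ev_coverSize hΓ) fun Δ x j hΔ hj hx => ?_)
  exact (ev_term hB (hΓ.mono hΔ) hm hj hs (hq.mono hΔ) hx (ht.mono hΔ) (hi.mono hΔ)
    (Ev.num 1)).congr (mul_one _)

theorem ev_offset {q : Code a} {j : Code b} {m n : ℕ} (hm : m < X) (hn : n < k)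
    (hq : Ev X A Γ q m) (hj : Ev X A Γ j n) : Ev X A Γ (offsetCode q j) (offset A k m n) := by
  have h := hB.slots
  refine Ev.sum _ (by omega) (ev_coverSize hΓ) fun Δ x j' hΔ hj' hx => ?_
  have hΓ' := hΓ.mono hΔ
  have hlt := order_lt (q := m) hB.pos hn
  exact Ev.ifLt (Ev.num 0) (Ev.cell 0 (by omega)
    (ev_order hB hΓ' hm hn (hq.mono hΔ) (hj.mono hΔ)) (ev_coverSize hΓ')
    (ev_order hB hΓ' hm hj' (hq.mono hΔ) hx))
    (fun _ => Ev.ifLt (hj.mono hΔ) hx (fun _ => Ev.num 1) fun _ => Ev.num (-1)) fun _ => Ev.num 0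

theorem ev_cost {q : Code a} {r : Code 1 → Code b} {z : Code 1 → Code 1 → Code c} {m : ℕ}
    (rv : ℕ → ℤ) (zv : ℕ → ℕ → ℤ) (hm : m < X) (hq : Ev X A Γ q m)
    (hr : ∀ Δ x j, Γ.Ext Δ → j < k → Ev X A Δ x (j : ℤ) → Ev X A Δ (r x) (rv j))
    (hz : ∀ Δ x y t i, Γ.Ext Δ → t < T → i < k + 1 → Ev X A Δ x (t : ℤ) → Ev X A Δ y (i : ℤ) →
      Ev X A Δ (z x y) (zv t i)) :
    Ev X A Γ (costCode q r z) (cost A k T m rv zv) := by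
  have h := hB.slots
  have h' := hB.types
  refine Ev.add ?_ ?_
  · refine Ev.sum (fun t => ∑ i ∈ range (k + 1), weight A k m t i * zv t i) (by omega)
      (ev_typeCount hΓ) fun Δ x t hΔ ht hx => ?_
    refine Ev.sum _ (by omega) (ev_slotCount (hΓ.mono hΔ)) fun Θ y i hΘ hi hy => ?_
    have hw := ev_weight hB (hΓ.mono (hΔ.trans hΘ)) hm ht (hq.mono (hΔ.trans hΘ)) (hx.mono hΘ) hy
    have h0 : 0 ≤ weight A k m t i := abs_nonneg _
    have h1 := weight_le A k m t i
    -- The weight is a natural number of at most k, so it can be the looping factor, whatever the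
    -- size of the entry of `z`.
    obtain ⟨w, hw'⟩ := Int.eq_ofNat_of_zero_le h0
    rw [hw'] at hw h1 ⊢
    exact hw.mul (by omega) (hz _ _ _ t i (hΔ.trans hΘ) ht hi (hx.mono hΘ) hy)
  · refine Ev.sum _ (by omega) (ev_coverSize hΓ) fun Δ x j hΔ hj hx => ?_
    refine Ev.abs (Ev.sub ?_ (hr Δ x j hΔ hj hx))
    refine Ev.sum (fun t => ∑ i ∈ range (k + 1), coefficient A k m j t i * zv t i) (by omega)
      (ev_typeCount (hΓ.mono hΔ)) fun Θ y t hΘ ht hy => ?_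
    refine Ev.sum _ (by omega) (ev_slotCount (hΓ.mono (hΔ.trans hΘ))) fun Ξ w i hΞ hi hw => ?_
    have hΓΞ := hΔ.trans (hΘ.trans hΞ)
    exact ev_term hB (hΓ.mono hΓΞ) hm hj ht (hq.mono hΓΞ) (hx.mono (hΘ.trans hΞ)) (hy.mono hΞ) hw
      (hz _ _ _ t i hΓΞ ht hi (hy.mono hΞ) hw)

theorem ev_entryIndex {t : Code a} {i : Code b} {m n : ℕ} (hm : m < T) (ht : Ev X A Γ t m)
    (hi : Ev X A Γ i n) : Ev X A Γ (entryIndex t i) ((m * (k + 1) + n : ℕ) : ℤ) :=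
  ((ht.mul (by have := hB.types; omega) (ev_slotCount hΓ)).add hi).congr (by push_cast; ring)

omit hB hΓ in
theorem ev_unit {u : Code a} {v : Code b} {m n : ℕ} (hu : Ev X A Γ u m) (hv : Ev X A Γ v n) :
    Ev X A Γ (unitCode u v) (if m = n then 1 else 0) := by
  refine (Ev.ifLt hu hv (fun _ => Ev.num 0)
    fun _ => Ev.ifLt hv hu (fun _ => Ev.num 0) fun _ => Ev.num 1).congr ?_
  split_ifs <;> omega

theorem ev_sum {x : Code a} {u : Code b} {m n : ℕ} (hm : m < side k T ^ k * side k T ^ k)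
    (hx : Ev X A Γ x m) (hu : Ev X A Γ u n) :
    Ev X A Γ (sumCode x u) (A 7 ((m / side k T ^ k : ℕ) * (T * (k + 1) : ℕ) + n) +
      A 7 ((m % side k T ^ k : ℕ) * (T * (k + 1) : ℕ) + n)) := by
  have hs : 0 < side k T ^ k := Nat.pow_pos (by unfold side; omega)
  have hm' : m < X := hm.trans_le hB.table_sq
  exact (Ev.cell 7 ((Nat.div_le_self _ _).trans hm'.le) (hx.div hm' hs (ev_tableSize hB hΓ))
    (ev_vectorSize hB hΓ) hu).add (Ev.cell 7 ((Nat.mod_le _ _).trans hm'.le)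
      (hx.mod hm' hs (ev_tableSize hB hΓ)) (ev_vectorSize hB hΓ) hu)

theorem ev_add {t : Code c} {x : Code a} {u : Code b} {s m n : ℕ} (hs : s < T)
    (hm : m < side k T ^ k * (k + 1)) (ht : Ev X A Γ t s) (hx : Ev X A Γ x m) (hu : Ev X A Γ u n) :
    Ev X A Γ (addCode t x u) (A 7 ((m / (k + 1) : ℕ) * (T * (k + 1) : ℕ) + n) +
      if n = s * (k + 1) + m % (k + 1) then 1 else 0) := by
  have hm' : m < X := hm.trans_le hB.table_slots
  exact (Ev.cell 7 ((Nat.div_le_self _ _).trans hm'.le) (hx.div hm' k.succ_pos (ev_slotCount hΓ))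
    (ev_vectorSize hB hΓ) hu).add (ev_unit hu (ev_entryIndex hB hΓ hs ht
      (hx.mod hm' k.succ_pos (ev_slotCount hΓ))))

end Evaluation

end ImbalanceProgram

/-! ### Correctness of the two updates of the table -/

namespace ImbalanceProgram

open RAM BlockProgram Finset

theorem coefficient_congr {A A' : ℕ → ℤ → ℤ} (h : A' 1 = A 1) (k q : ℕ) :
    coefficient A' k q = coefficient A k q := by
  funext j t i; simp only [coefficient, h]

theorem weight_congr {A A' : ℕ → ℤ → ℤ} (h : A' 1 = A 1) (k q : ℕ) :
    weight A' k q = weight A k q := by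
  funext t i; simp only [weight, coefficient_congr h]

theorem offset_congr {A A' : ℕ → ℤ → ℤ} (h : A' 0 = A 0) (k q : ℕ) :
    offset A' k q = offset A k q := by
  funext j; simp only [offset, h]

theorem cost_congr {A A' : ℕ → ℤ → ℤ} (h : A' 1 = A 1) (k T q : ℕ) :
    cost A' k T q = cost A k T q := by
  funext r z; simp only [cost, coefficient_congr h, weight_congr h]

theorem index_lt {t i T n : ℕ} (ht : t < T) (hi : i < n) : t * n + i < T * n := by
  have : (t + 1) * n ≤ T * n := Nat.mul_le_mul_right _ ht
  rw [Nat.succ_mul] at this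
  omega

variable {X Y : ℕ} [hX : X.AtLeastTwo] {A : ℕ → ℤ → ℤ} {Γ : Ctx} {k T : ℕ} {a b c d e : ℕ}

/-- The new table is built in array 8 and copied to array 7 only at the end, because the candidates
are sums that read the old table. So `f` and `g` need to be correct only while all arrays except 8
are unchanged. -/
theorem tr_improve (hB : Bounds X k T) (hΓ : Knows Γ k T) {q : Code a} {n : Code b}
    {f : Code 1 → Code 1 → Code 1 → Code c} {g : Code 1 → Code 1 → Code d} {m N : ℕ}
    (C : ℕ → ℕ → ℤ) (hm : m < X) (hq : ∀ A', Ev X A' Γ q m) (hN0 : 0 < N) (hN : N ≤ X)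
    (hn : ∀ A', Ev X A' Γ n N)
    (hg : ∀ Δ x u s v A', Γ.Ext Δ → s < N → v < T * (k + 1) → (∀ j ≠ 8, A' j = A j) →
      Ev X A' Δ x (s : ℤ) → Ev X A' Δ u (v : ℤ) → Ev X A' Δ (g x u) (C s v))
    (hf : ∀ Δ x y w s t i A', Γ.Ext Δ → s < N → t < T → i < k + 1 → (∀ j ≠ 8, A' j = A j) →
      Ev X A' Δ x (s : ℤ) → Ev X A' Δ y (t : ℤ) → Ev X A' Δ w (i : ℤ) →
      Ev X A' Δ (f x y w) (C s (t * (k + 1) + i))) :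
    Tr X Y Γ (improve q n f g) A fun A' => (∀ j, j ≠ 7 → j ≠ 8 → A' j = A j) ∧
      IsBest k T (coefficient A k m) (weight A k m) (side k T ^ k) (target k T) N
        (fun s t i => C s (t * (k + 1) + i)) (entry k T (A' 7)) := by
  set F : ℕ → ℕ → ℤ := fun p s => cost A k T m (target k T p) (fun t i => C s (t * (k + 1) + i))
    with hF
  refine Tr.seq (P := fun A' => (∀ j ≠ 8, A' j = A j) ∧ ∀ p < side k T ^ k, ∀ u < T * (k + 1),
      A' 8 ((p : ℤ) * (T * (k + 1) : ℕ) + u) = C (firstMin (F p) N) u) ?_ ?_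
  · refine Tr.forTo (fun p' A' => (∀ j ≠ 8, A' j = A j) ∧ ∀ p < p', ∀ u < T * (k + 1),
      A' 8 ((p : ℤ) * (T * (k + 1) : ℕ) + u) = C (firstMin (F p) N) u) hB.table.le
      (ev_tableSize hB hΓ) ⟨fun _ _ => rfl, by simp⟩ ?_
    rintro Δ x p A₁ hΔ hp hx ⟨h8, hval⟩
    have hpX : p < X := hp.trans hB.table
    refine Tr.bind (z := firstMin (F p) N) ?_ ?_
    · refine Ev.argmin (F p) hN ((hn A₁).mono hΔ) fun Θ y s hΘ hs hy => ?_
      have hΓΘ := hΔ.trans hΘ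
      rw [hF]
      simp only
      rw [← cost_congr (h8 1 (by norm_num))]
      refine ev_cost hB (hΓ.mono hΓΘ) _ _ hm ((hq A₁).mono hΓΘ) ?_ ?_
      · intro Ξ w j hΞ hj hw
        exact ev_target hB (hΓ.mono (hΓΘ.trans hΞ)) hpX hj ((hx A₁).mono (hΘ.trans hΞ)) hw
      · intro Ξ v w t i hΞ ht hi hv hw
        exact hf Ξ y v w s t i A₁ (hΓΘ.trans hΞ) hs ht hi h8 (hy.mono hΞ) hv hw
    · intro Θ y hΘ hy
      have hΓΘ := hΔ.trans hΘ
      refine (Tr.fill (b := (p : ℤ) * (T * (k + 1) : ℕ)) (C (firstMin (F p) N)) 8 hB.vector ?_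
        (ev_vectorSize hB (hΓ.mono hΓΘ)) ?_).imp ?_
      · intro A' _
        exact ((hx A').mono hΘ).mul hpX.le (ev_vectorSize hB (hΓ.mono hΓΘ))
      · intro Ξ u v A' hΞ hv h8' hu
        refine hg Ξ y u _ v A' (hΓΘ.trans hΞ) (firstMin_spec _ hN0).1 hv
          (fun j hj => (h8' j hj).trans (h8 j hj)) ((hy A').mono hΞ) hu
      · rintro A' ⟨h1, h2, h3⟩
        refine ⟨fun j hj => (h1 j hj).trans (h8 j hj), fun p' hp' u hu => ?_⟩
        rcases Nat.lt_succ_iff_lt_or_eq.1 hp' with h | rfl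
        · rw [h3 _ (Or.inl _), hval p' h u hu]
          exact_mod_cast index_lt h hu
        · exact h2 u hu
  · rintro A₁ ⟨h8, hval⟩
    refine (Tr.fill (b := 0) (N := side k T ^ k * (T * (k + 1))) (fun u => A₁ 8 u) 7
      hB.table_vector (fun _ _ => Ev.num 0) ?_ ?_).imp ?_
    · exact ((ev_tableSize hB hΓ).mul hB.table.le (ev_vectorSize hB hΓ)).congr (by push_cast; ring)
    · intro Δ u v A' _ _ h7 hu
      exact (hu.read 8).congr (by rw [h7 8 (by norm_num)])
    · rintro A' ⟨h1, h2, -⟩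
      refine ⟨fun j hj hj' => (h1 j hj).trans (h8 j hj'), fun p hp => ?_⟩
      refine ⟨firstMin (F p) N, (firstMin_spec _ hN0).1, ?_, (firstMin_spec (F p) hN0).2⟩
      intro t ht i hi
      have hu := index_lt ht hi
      have h := h2 _ (index_lt hp hu)
      rw [zero_add] at h
      simp only at h
      beta_reduce
      rw [← hval p hp _ hu]
      unfold entry
      push_cast at h ⊢
      exact h

theorem side_pow_pos (k T : ℕ) : 0 < side k T ^ k := Nat.pow_pos (by unfold side; omega)

/-- Shifting the coordinates by the radius R makes them digits from 0 to 2R, which is why `side` is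
2R + 1. -/
theorem exists_target {r : ℕ → ℤ} (hr : ∀ j < k, |r j| ≤ (4 * ((T + 2) * k) : ℕ)) :
    ∃ p < side k T ^ k, ∀ j < k, target k T p j = r j := by
  have hb : ∀ j < k, 0 ≤ r j + (4 * ((T + 2) * k) : ℕ) ∧
      r j + (4 * ((T + 2) * k) : ℕ) < side k T := fun j hj => by
    have := abs_le.1 (hr j hj)
    unfold side
    omega
  obtain ⟨p, hp, h⟩ := exists_digits (b := side k T) (n := k)
    (fun j => (r j + (4 * ((T + 2) * k) : ℕ)).toNat) fun j hj => by have := hb j hj; omega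
  refine ⟨p, hp, fun j hj => ?_⟩
  have := hb j hj
  rw [target, h j hj]
  omega

/-- The arrays hold a table for the order with number `q`. -/
def HoldsTable (A : ℕ → ℤ → ℤ) (k T q : ℕ) (ν : ℕ → ℤ) (ρ : ℤ) : Prop :=
  IsTable k T (coefficient A k q) (weight A k q) (side k T ^ k) (target k T) ν ρ (entry k T (A 7))

theorem tr_double (hB : Bounds X k T) (hΓ : Knows Γ k T) {q : Code a} {m : ℕ} (hm : m < X)
    (hq : ∀ A', Ev X A' Γ q m) {ν : ℕ → ℤ}
    (hA : HoldsTable A k T m ν ((4 * ((T + 2) * k) : ℕ) - T)) :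
    Tr X Y Γ (doubleTable q) A fun A' => (∀ j, j ≠ 7 → j ≠ 8 → A' j = A j) ∧
      HoldsTable A' k T m (fun t => 2 * ν t) (4 * ((T + 2) * k) : ℕ) := by
  refine (tr_improve (N := side k T ^ k * side k T ^ k) hB hΓ
    (fun s v => A 7 ((s / side k T ^ k : ℕ) * (T * (k + 1) : ℕ) + v) +
      A 7 ((s % side k T ^ k : ℕ) * (T * (k + 1) : ℕ) + v)) hm hq
    (Nat.mul_pos (side_pow_pos k T) (side_pow_pos k T)) hB.table_sq ?_ ?_ ?_).imp ?_
  · exact fun A' => ((ev_tableSize hB hΓ).mul hB.table.le (ev_tableSize hB hΓ)).congr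
      (by push_cast; ring)
  · intro Δ x u s v A' hΔ hs hv h8 hx hu
    rw [← h8 7 (by norm_num)]
    exact ev_sum hB (hΓ.mono hΔ) hs hx hu
  · intro Δ x y w s t i A' hΔ hs ht hi h8 hx hy hw
    rw [← h8 7 (by norm_num)]
    exact ev_sum hB (hΓ.mono hΔ) hs hx (ev_entryIndex hB (hΓ.mono hΔ) ht hy hw)
  · rintro A' ⟨h1, h2⟩
    refine ⟨h1, ?_⟩
    rw [HoldsTable, coefficient_congr (h1 1 (by norm_num) (by norm_num)),
      weight_congr (h1 1 (by norm_num) (by norm_num))]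
    have hk := hB.pos
    -- With R = 4(T+2)k and `ρ` = R - T, the condition R + T(k+1) + 1 ≤ 2`ρ` reads Tk + 3T + 1 ≤
    -- 4(T+2)k, which holds because k ≥ 1.
    refine IsTable.double (abs_coefficient_le A k m) (fun r hr => exists_target hr)
      (by omega) ?_ hA ?_
    · push_cast
      have : (1 : ℤ) ≤ k := by exact_mod_cast hk
      nlinarith
    · simpa only [entry, Nat.cast_add, Nat.cast_mul] using h2

theorem tr_add (hB : Bounds X k T) (hΓ : Knows Γ k T) {q : Code a} {t₀ : Code c} {m s₀ : ℕ}
    (hm : m < X) (hs₀ : s₀ < T) (hq : ∀ A', Ev X A' Γ q m) (ht₀ : ∀ A', Ev X A' Γ t₀ s₀)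
    {ν : ℕ → ℤ} (hν : 0 ≤ ν s₀) {ρ : ℤ} (hρ : ρ + 1 ≤ (4 * ((T + 2) * k) : ℕ))
    (hA : HoldsTable A k T m ν (ρ + 1)) :
    Tr X Y Γ (addToTable q t₀) A fun A' => (∀ j, j ≠ 7 → j ≠ 8 → A' j = A j) ∧
      HoldsTable A' k T m (fun t => ν t + if t = s₀ then 1 else 0) ρ := by
  refine (tr_improve (N := side k T ^ k * (k + 1)) hB hΓ
    (fun s v => A 7 ((s / (k + 1) : ℕ) * (T * (k + 1) : ℕ) + v) +
      if v = s₀ * (k + 1) + s % (k + 1) then 1 else 0) hm hq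
    (Nat.mul_pos (side_pow_pos k T) k.succ_pos) hB.table_slots ?_ ?_ ?_).imp ?_
  · exact fun A' => ((ev_tableSize hB hΓ).mul hB.table.le (ev_slotCount hΓ)).congr
      (by push_cast; ring)
  · intro Δ x u s v A' hΔ hs hv h8 hx hu
    rw [← h8 7 (by norm_num)]
    exact ev_add hB (hΓ.mono hΔ) hs₀ hs ((ht₀ A').mono hΔ) hx hu
  · intro Δ x y w s t i A' hΔ hs ht hi h8 hx hy hw
    rw [← h8 7 (by norm_num)]
    exact ev_add hB (hΓ.mono hΔ) hs₀ hs ((ht₀ A').mono hΔ) hx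
      (ev_entryIndex hB (hΓ.mono hΔ) ht hy hw)
  · rintro A' ⟨h1, h2⟩
    refine ⟨h1, ?_⟩
    rw [HoldsTable, coefficient_congr (h1 1 (by norm_num) (by norm_num)),
      weight_congr (h1 1 (by norm_num) (by norm_num))]
    refine IsTable.add_unit hs₀ (abs_coefficient_le A k m) (fun r hr => exists_target hr)
      hρ hν hA ?_
    intro p hp
    obtain ⟨s, hs, hsame, hmin⟩ := h2 p hp
    -- Positions inside a vector determine type and slot, so comparing positions yields the unit
    -- vector.
    have key : ∀ s, Same k T (fun t i => A 7 ((s / (k + 1) : ℕ) * (T * (k + 1) : ℕ) +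
          (t * (k + 1) + i : ℕ)) + if t * (k + 1) + i = s₀ * (k + 1) + s % (k + 1) then 1 else 0)
        (fun t i => entry k T (A 7) (s / (k + 1)) t i + unit s₀ (s % (k + 1)) t i) := by
      intro s t ht i hi
      have hiff : t * (k + 1) + i = s₀ * (k + 1) + s % (k + 1) ↔ t = s₀ ∧ i = s % (k + 1) := by
        have hlt := Nat.mod_lt s k.succ_pos
        constructor
        · intro h
          have h1 := congrArg (· / (k + 1)) h
          simp only [Nat.mul_comm _ (k + 1), Nat.mul_add_div k.succ_pos, Nat.div_eq_of_lt hi,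
            Nat.div_eq_of_lt hlt, add_zero] at h1
          subst h1
          exact ⟨rfl, by omega⟩
        · rintro ⟨rfl, rfl⟩; rfl
      simp only [entry, unit, hiff]
      push_cast
      rfl
    refine ⟨s, hs, fun t ht i hi => (hsame t ht i hi).trans (key s t ht i hi), fun s' hs' => ?_⟩
    have := hmin s' hs'
    rwa [value_congr (key s) fun _ _ => rfl, value_congr (key s') fun _ _ => rfl] at this

end ImbalanceProgram

/-! ### Processing the type counts bit by bit, and the whole program -/

namespace ImbalanceProgram

open RAM BlockProgram Finset

variable {X Y : ℕ} [hX : X.AtLeastTwo] {A : ℕ → ℤ → ℤ} {Γ : Ctx} {k T : ℕ} {a b c d : ℕ}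

/-- The arrays hold a table, and the remainders with respect to its block sums: the bits of the
numbers `n t` from bit `e` on have been processed if `t < t'`, those from bit `e + 1` on
otherwise. -/
def Processed (n : ℕ → ℕ) (A : ℕ → ℤ → ℤ) (k T q e t' : ℕ) (ρ : ℤ) : Prop :=
  ∃ ν : ℕ → ℤ, (∀ t, 0 ≤ ν t) ∧ HoldsTable A k T q ν ρ ∧
    ∀ t < T, A 9 t = n t - 2 ^ e * ν t ∧ 0 ≤ A 9 t ∧ A 9 t < if t < t' then 2 ^ e else 2 ^ (e + 1)

theorem HoldsTable.mono {A' : ℕ → ℤ → ℤ} {q : ℕ} {ν : ℕ → ℤ} {ρ ρ' : ℤ}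
    (h : HoldsTable A k T q ν ρ) (h1 : A' 1 = A 1) (h7 : A' 7 = A 7) (hρ : ρ' ≤ ρ) :
    HoldsTable A' k T q ν ρ' := by
  rw [HoldsTable, coefficient_congr h1, weight_congr h1, h7]
  exact fun p hp => ⟨(h p hp).1, fun hr => (h p hp).2 fun j hj => (hr j hj).trans hρ⟩

/-- Doubling restores the full radius R, and each type in turn gives up one unit of it, whether or
not its bit is set. The stage therefore ends with R - T, exactly what the next doubling requires. -/
theorem tr_stage (hB : Bounds X k T) (hΓ : Knows Γ k T) {q : Code a} {l : Code b} {s : Code c}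
    {m L s₀ e : ℕ} {n : ℕ → ℕ} (hm : m < X) (hq : ∀ A', Ev X A' Γ q m)
    (hl : ∀ A', Ev X A' Γ l L) (hs : ∀ A', Ev X A' Γ s s₀) (he : s₀ + 1 + e = L)
    (h5 : A 5 e = 2 ^ e)
    (hA : Processed n A k T m (e + 1) T ((4 * ((T + 2) * k) : ℕ) - T)) :
    Tr X Y Γ (stage q l s) A fun A' => (∀ j, j ≠ 7 → j ≠ 8 → j ≠ 9 → A' j = A j) ∧
      Processed n A' k T m e T ((4 * ((T + 2) * k) : ℕ) - T) := by
  obtain ⟨ν, hν, hT, h9⟩ := hA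
  refine Tr.seq (tr_double hB hΓ hm hq hT) ?_
  rintro A₁ ⟨hkeep, hT₁⟩
  have hpow : ∀ A', (∀ j, j ≠ 7 → j ≠ 8 → j ≠ 9 → A' j = A j) → ∀ Δ, Γ.Ext Δ →
      Ev X A' Δ (Code.read 5 ((l.sub (.num 1)).sub s)) (2 ^ e) := by
    intro A' hA' Δ hΔ
    refine (Ev.read 5 ((((hl A').sub (Ev.num 1)).sub (hs A')).mono hΔ)).congr ?_
    rw [hA' 5 (by norm_num) (by norm_num) (by norm_num), ← h5]
    congr 1
    omega
  refine (Tr.forTo (fun t' A' => (∀ j, j ≠ 7 → j ≠ 8 → j ≠ 9 → A' j = A j) ∧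
    Processed n A' k T m e t' ((4 * ((T + 2) * k) : ℕ) - t')) (by have := hB.types; omega)
    (ev_typeCount hΓ) ?_ ?_).imp fun A' h => h
  · refine ⟨fun j h7 h8 _ => hkeep j h7 h8, fun t => 2 * ν t, fun t =>
      mul_nonneg two_pos.le (hν t), by simpa using hT₁, fun t ht => ?_⟩
    rw [hkeep 9 (by norm_num) (by norm_num)]
    obtain ⟨h1, h2, h3⟩ := h9 t ht
    refine ⟨by rw [h1]; ring, h2, by simpa [ht] using h3⟩
  · rintro Δ x t A₂ hΔ ht hx ⟨hkeep₂, ν', hν', hT₂, h9₂⟩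
    have h9x : Ev X A₂ Δ (Code.read 9 x) (A₂ 9 t) := (hx A₂).read 9
    have hp := hpow A₂ hkeep₂ Δ hΔ
    -- The remainder of type `t` is below 2^(e+1), so bit `e` of its count is set exactly if the
    -- remainder is at least 2^e. If it is not set, only the radius is weakened.
    refine Tr.ifLt h9x hp (fun hlt => Tr.skip ⟨hkeep₂, ν', hν',
      hT₂.mono rfl rfl (by push_cast; omega), fun t₁ ht₁ => ?_⟩) fun hge => ?_
    · obtain ⟨h1, h2, h3⟩ := h9₂ t₁ ht₁
      refine ⟨h1, h2, ?_⟩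
      by_cases htt : t₁ = t
      · subst htt; simpa using hlt
      · have : t₁ < t + 1 ↔ t₁ < t := by omega
        simpa only [this] using h3
    · refine Tr.seq (P := fun A' => A' = setArr A₂ 9 t (A₂ 9 t - 2 ^ e))
        (Tr.write 9 (hx A₂) (h9x.sub hp) rfl) ?_
      rintro A₃ rfl
      have hT₃ : HoldsTable (setArr A₂ 9 t (A₂ 9 t - 2 ^ e)) k T m ν'
          ((4 * ((T + 2) * k) : ℕ) - ((t + 1 : ℕ) : ℤ) + 1) :=
        hT₂.mono (by simp [setArr]) (by simp [setArr]) (by push_cast; omega)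
      refine (tr_add hB (hΓ.mono hΔ) hm ht (fun A' => (hq A').mono hΔ) hx (hν' t)
        (by push_cast; omega) hT₃).imp ?_
      rintro A₄ ⟨hkeep₄, hT₄⟩
      refine ⟨fun j h7 h8 h9 => ?_, _, fun t₁ => ?_, hT₄, fun t₁ ht₁ => ?_⟩
      · rw [hkeep₄ j h7 h8, ← hkeep₂ j h7 h8 h9]; simp [setArr, h9]
      · have := hν' t₁
        split_ifs <;> omega
      · rw [hkeep₄ 9 (by norm_num) (by norm_num)]
        obtain ⟨h1, h2, h3⟩ := h9₂ t₁ ht₁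
        by_cases htt : t₁ = t
        · subst htt
          simp only [setArr, Function.update_self, lt_irrefl, if_false, if_true, lt_add_one] at h3 ⊢
          rw [pow_succ] at h3
          refine ⟨by rw [h1]; ring, by omega, by omega⟩
        · have htt' : (t₁ : ℤ) ≠ t := by omega
          have : t₁ < t + 1 ↔ t₁ < t := by omega
          simp only [setArr, Function.update_self, Function.update_of_ne htt', htt, if_false,
            add_zero, this]
          exact ⟨h1, h2, h3⟩

/-- The vector with number `q` in the list `F` is optimal for the order with number `q`. -/
def Solved (n : ℕ → ℕ) (A : ℕ → ℤ → ℤ) (k T q : ℕ) (F : ℤ → ℤ) : Prop :=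
  Feasible k T (fun t => n t) (entry k T F q) ∧ ∀ z, Feasible k T (fun t => n t) z →
    cost A k T q (fun j => -offset A k q j) (entry k T F q) ≤
      cost A k T q (fun j => -offset A k q j) z

theorem ev_target_cost (hB : Bounds X k T) (hΓ : Knows Γ k T) {i : ℕ} {q : Code a} {p : Code b}
    {m v : ℕ} (hm : m < X) (hv : v ≤ X) (hq : Ev X A Γ q m) (hp : Ev X A Γ p v) :
    Ev X A Γ (costCode q (fun j => (Code.num 0).sub (offsetCode q j))
      fun t i' => .cell i p vectorSize (entryIndex t i'))
      (cost A k T m (fun j => -offset A k m j) (entry k T (A i) v)) := by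
  refine ev_cost hB hΓ _ _ hm hq (fun Δ x j hΔ hj hx => ?_) fun Δ x y t i' hΔ ht hi hx hy => ?_
  · exact ((Ev.num 0).sub (ev_offset hB (hΓ.mono hΔ) hm hj (hq.mono hΔ) hx)).congr (by ring)
  · have hΓ' := hΓ.mono hΔ
    exact (Ev.cell i hv (hp.mono hΔ) (ev_vectorSize hB hΓ')
      (ev_entryIndex hB hΓ' ht hx hy)).congr (by simp only [entry]; push_cast; rfl)

theorem tr_solve (hB : Bounds X k T) (hΓ : Knows Γ k T) {q : Code a} {l : Code b}
    {m L : ℕ} {n : ℕ → ℕ} (hm : m < k ^ k) (hq : ∀ A', Ev X A' Γ q m) (hL : L ≤ Y)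
    (hl : ∀ A', Ev X A' Γ l L) (h2 : ∀ t < T, A 2 t = n t) (hn : ∀ t < T, n t < 2 ^ L)
    (h5 : ∀ e < L, A 5 e = 2 ^ e) :
    Tr X Y Γ (solve q l) A fun A' => (∀ j < 6, A' j = A j) ∧
      (∀ m' < m, ∀ u < T * (k + 1),
        A' 6 ((m' : ℤ) * (T * (k + 1) : ℕ) + u) = A 6 ((m' : ℤ) * (T * (k + 1) : ℕ) + u)) ∧
      Solved n A k T m (A' 6) := by
  have hmX : m < X := hm.trans hB.order_lt
  have hT := hB.types
  refine Tr.seq (Tr.fill (b := 0) (N := side k T ^ k * (T * (k + 1))) (fun _ => 0) 7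
    hB.table_vector (fun _ _ => Ev.num 0) (((ev_tableSize hB hΓ).mul hB.table.le
    (ev_vectorSize hB hΓ)).congr (by push_cast; ring)) fun _ _ _ _ _ _ _ _ => Ev.num 0) ?_
  rintro A₁ ⟨hk₁, h7, -⟩
  refine Tr.seq (Tr.fill (b := 0) (N := T) (fun t => n t) 9 (by omega) (fun _ _ => Ev.num 0)
    (ev_typeCount hΓ) fun Δ x t A' hΔ ht hA' hx => (hx.read 2).congr ?_) ?_
  · rw [hA' 2 (by norm_num), hk₁ 2 (by norm_num), h2 t ht]
  rintro A₂ ⟨hk₂, h9, -⟩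
  -- The invariant starts with bit L, where all block sums are zero and the remainders are the full
  -- counts, below 2^L.
  refine Tr.seq (Tr.forTo_long (fun s A' => (∀ j, j ≠ 7 → j ≠ 8 → j ≠ 9 → A' j = A j) ∧
    Processed n A' k T m (L - s) T ((4 * ((T + 2) * k) : ℕ) - T)) hL (hl A₂) ?_ ?_) ?_
  · refine ⟨fun j h _ h' => (hk₂ j h').trans (hk₁ j h), fun _ => 0, fun _ => le_rfl, ?_, ?_⟩
    · refine isTable_zero.congr fun p hp t ht i hi => ?_
      have h := h7 _ (index_lt hp (index_lt ht hi))
      rw [zero_add] at h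
      simp only [entry]
      rw [hk₂ 7 (by norm_num)]
      push_cast at h ⊢
      exact h
    · intro t ht
      have h := h9 t ht
      rw [zero_add] at h
      have := hn t ht
      rw [h]
      refine ⟨by simp, by positivity, ?_⟩
      simp only [ht, if_true, Nat.sub_zero]
      exact_mod_cast this
  · rintro Δ x s A' hΔ hs hx ⟨hk', hP⟩
    have he : s + 1 + (L - (s + 1)) = L := by omega
    refine (tr_stage (n := n) hB (hΓ.mono hΔ) hmX (fun B => (hq B).mono hΔ) (fun B => (hl B).mono hΔ) hx he
      ?_ ?_).imp ?_
    · rw [hk' 5 (by norm_num) (by norm_num) (by norm_num)]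
      exact h5 _ (by omega)
    · rwa [show L - (s + 1) + 1 = L - s by omega]
    · rintro A'' ⟨hk'', hP'⟩
      exact ⟨fun j h7 h8 h9 => (hk'' j h7 h8 h9).trans (hk' j h7 h8 h9), hP'⟩
  rintro A₃ ⟨hk₃, ν, -, hT₃, h9₃⟩
  have hk1 : A₃ 1 = A 1 := hk₃ 1 (by norm_num) (by norm_num) (by norm_num)
  have hk0 : A₃ 0 = A 0 := hk₃ 0 (by norm_num) (by norm_num) (by norm_num)
  -- At bit 0 the remainders lie in [0, 1), so they vanish and the block sums are the type counts.
  have hν : ∀ t < T, ν t = n t := by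
    intro t ht
    obtain ⟨e1, e2, e3⟩ := h9₃ t ht
    simp only [ht, if_true, Nat.sub_self, pow_zero, one_mul] at e1 e3
    omega
  replace hT₃ := IsTable.congr_sums hT₃ hν
  rw [coefficient_congr hk1, weight_congr hk1] at hT₃
  set F : ℕ → ℤ := fun p => cost A k T m (fun j => -offset A k m j) (entry k T (A₃ 7) p) with hF
  obtain ⟨hlt, hmin⟩ := firstMin_spec F (side_pow_pos k T)
  refine Tr.bind (z := firstMin F (side k T ^ k)) ?_ ?_
  · refine Ev.argmin F hB.table.le (ev_tableSize hB hΓ) fun Δ x p hΔ hp hx => ?_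
    have := ev_target_cost (i := 7) hB (hΓ.mono hΔ) hmX (hp.trans hB.table).le
      ((hq A₃).mono hΔ) hx
    rwa [cost_congr hk1, offset_congr hk0] at this
  · intro Δ x hΔ hx
    have hΓ' := hΓ.mono hΔ
    refine (Tr.fill (b := (m : ℤ) * (T * (k + 1) : ℕ)) (fun u => A₃ 7
      ((firstMin F (side k T ^ k) : ℕ) * (T * (k + 1) : ℕ) + u)) 6 hB.vector
      (fun B _ => ((hq B).mono hΔ).mul hmX.le (ev_vectorSize hB hΓ')) (ev_vectorSize hB hΓ')
      ?_).imp ?_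
    · intro Θ y u B hΘ hu hB' hy
      rw [← hB' 7 (by norm_num)]
      exact Ev.cell 7 (hlt.trans hB.table).le ((hx B).mono hΘ) (ev_vectorSize hB (hΓ'.mono hΘ)) hy
    · rintro A₄ ⟨hk₄, h6, h6'⟩
      have hsame : Same k T (entry k T (A₄ 6) m) (entry k T (A₃ 7) (firstMin F (side k T ^ k))) := by
        intro t ht i hi
        have h := h6 _ (index_lt ht hi)
        simp only [entry]
        push_cast at h ⊢
        exact h
      refine ⟨fun j hj => (hk₄ j (by omega)).trans (hk₃ j (by omega) (by omega) (by omega)),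
        fun m' hm' u hu => ?_, (hT₃ _ hlt).1.congr hsame, fun z hz => ?_⟩
      · rw [h6' _ (Or.inl _), hk₃ 6 (by norm_num) (by norm_num) (by norm_num)]
        exact_mod_cast index_lt hm' hu
      -- The target that matters is the negative of the offset. Its coordinates are at most k ≤ R -
      -- T in absolute value, so the table is optimal there. The program need not know its number
      -- `p`: it takes the entry that is best for this target, and all entries are feasible.
      · obtain ⟨p, hp, hpt⟩ := exists_target (k := k) (T := T) (r := fun j => -offset A k m j)
          (fun j hj => by
            rw [abs_neg]
            refine (abs_offset_le A k m j).trans ?_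
            push_cast; nlinarith)
        have hρ : ∀ j < k, |target k T p j| ≤ (4 * ((T + 2) * k) : ℕ) - (T : ℤ) := by
          intro j hj
          rw [hpt j hj, abs_neg]
          refine (abs_offset_le A k m j).trans ?_
          have := hB.pos
          push_cast
          nlinarith
        have h := (hT₃ p hp).2 hρ z hz
        rw [value_congr (fun _ _ _ _ => rfl) hpt, value_congr (fun _ _ _ _ => rfl) hpt] at h
        refine (value_congr hsame fun _ _ => rfl).trans_le ((hmin p hp).trans h)

theorem tr_main (hB : Bounds X k T) (hΓ : Knows Γ k T) {n : ℕ → ℕ}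
    (hY : (∑ t ∈ range T, n t).size ≤ Y) (h2 : ∀ t < T, A 2 t = n t) :
    Tr X Y Γ main A fun A' => ∃ m < k ^ k, ∃ z, (∀ j < k, A' 3 j = order k m j) ∧
      (∀ t < T, ∀ i < k + 1, A' 4 (t * (k + 1) + i) = z t i) ∧ Feasible k T (fun t => n t) z ∧
      ∀ m' < k ^ k, ∀ z', Feasible k T (fun t => n t) z' →
        cost A k T m (fun j => -offset A k m j) z ≤
          cost A k T m' (fun j => -offset A k m' j) z' := by
  have hk := hB.slots
  have hT := hB.types
  have hkk : Ev X A Γ (coverSize.pow coverSize) ((k ^ k : ℕ) : ℤ) :=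
    (ev_coverSize hΓ).pow (by omega) (by omega) (ev_coverSize hΓ)
  refine Tr.powersOfTwo (N := ∑ t ∈ range T, n t) hY ?_ ?_
  · refine (Ev.sum (fun t => (n t : ℤ)) (by omega) (ev_typeCount hΓ) fun Δ x t hΔ ht hx => ?_).congr
      (by push_cast; rfl)
    exact (hx.read 2).congr (h2 t ht)
  intro Δ x A₁ hΔ hx hk₁ h5
  have hΓ' := hΓ.mono hΔ
  refine Tr.seq (Tr.forTo (fun m' A' => (∀ j < 6, A' j = A₁ j) ∧
    ∀ m < m', Solved n A k T m (A' 6)) hB.order_lt.le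
    ((ev_coverSize hΓ').pow (by omega) (by omega) (ev_coverSize hΓ')) ⟨fun _ _ => rfl, by simp⟩ ?_) ?_
  · rintro Θ y m A₂ hΘ hm hy ⟨hk₂, hS⟩
    refine (tr_solve hB (hΓ'.mono hΘ) hm hy hY (fun B => (hx B).mono hΘ) (n := n) ?_ ?_ ?_).imp ?_
    · intro t ht
      rw [hk₂ 2 (by norm_num), hk₁ 2 (by norm_num), h2 t ht]
    · intro t ht
      exact (single_le_sum (f := n) (fun _ _ => Nat.zero_le _) (mem_range.2 ht)).trans_lt
        (Nat.lt_size_self _)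
    · intro e he
      rw [hk₂ 5 (by norm_num)]
      exact h5 e he
    · rintro A₃ ⟨hk₃, h6, hS'⟩
      refine ⟨fun j hj => (hk₃ j hj).trans (hk₂ j hj), fun m' hm' => ?_⟩
      rcases Nat.lt_succ_iff_lt_or_eq.1 hm' with h | rfl
      · have hsame : Same k T (entry k T (A₃ 6) m') (entry k T (A₂ 6) m') := by
          intro t ht i hi
          have h := h6 m' h _ (index_lt ht hi)
          simp only [entry]
          push_cast at h ⊢
          exact h
        exact ⟨(hS m' h).1.congr hsame, fun z hz =>
          (value_congr hsame fun _ _ => rfl).trans_le ((hS m' h).2 z hz)⟩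
      · have h1 : A₂ 1 = A 1 := (hk₂ 1 (by norm_num)).trans (hk₁ 1 (by norm_num))
        have h0 : A₂ 0 = A 0 := (hk₂ 0 (by norm_num)).trans (hk₁ 0 (by norm_num))
        rwa [Solved, cost_congr h1, offset_congr h0] at hS'
  rintro A₂ ⟨hk₂, hS⟩
  have h1 : A₂ 1 = A 1 := (hk₂ 1 (by norm_num)).trans (hk₁ 1 (by norm_num))
  have h0 : A₂ 0 = A 0 := (hk₂ 0 (by norm_num)).trans (hk₁ 0 (by norm_num))
  set F : ℕ → ℤ := fun m => cost A k T m (fun j => -offset A k m j) (entry k T (A₂ 6) m) with hF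
  obtain ⟨hlt, hmin⟩ := firstMin_spec F (Nat.pow_pos (n := k) hB.pos)
  have hltX := hlt.trans hB.order_lt
  refine Tr.bind (z := firstMin F (k ^ k)) ?_ ?_
  · refine Ev.argmin F hB.order_lt.le
      ((ev_coverSize hΓ').pow (by omega) (by omega) (ev_coverSize hΓ')) fun Θ y m hΘ hm hy => ?_
    have hmX := hm.trans hB.order_lt
    have := ev_target_cost (i := 6) hB (hΓ'.mono hΘ) hmX hmX.le hy hy
    rwa [cost_congr h1, offset_congr h0] at this
  · intro Θ y hΘ hy
    have hΓΘ := hΓ'.mono hΘ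
    refine Tr.seq (Tr.fill (b := 0) (fun j => (order k (firstMin F (k ^ k)) j : ℤ)) 3 (by omega)
      (fun _ _ => Ev.num 0) (ev_coverSize hΓΘ) fun Ξ w j B hΞ hj _ hw =>
        ev_order hB (hΓΘ.mono hΞ) hltX hj ((hy B).mono hΞ) hw) ?_
    rintro A₃ ⟨hk₃, h3, -⟩
    refine (Tr.fill (b := 0) (fun u => A₂ 6 ((firstMin F (k ^ k) : ℕ) * (T * (k + 1) : ℕ) + u)) 4
      hB.vector (fun _ _ => Ev.num 0) (ev_vectorSize hB hΓΘ) fun Ξ w u B hΞ hu hB' hw => ?_).imp ?_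
    · rw [← hk₃ 6 (by norm_num), ← hB' 6 (by norm_num)]
      exact Ev.cell 6 hltX.le ((hy B).mono hΞ) (ev_vectorSize hB (hΓΘ.mono hΞ)) hw
    · rintro A₄ ⟨hk₄, h4, -⟩
      refine ⟨firstMin F (k ^ k), hlt, entry k T (A₂ 6) (firstMin F (k ^ k)), fun j hj => ?_,
        fun t ht i hi => ?_, (hS _ hlt).1, fun m' hm' z' hz' =>
        (hmin m' hm').trans ((hS m' hm').2 z' hz')⟩
      · have h := h3 j hj
        rw [zero_add] at h
        rw [hk₄ 3 (by norm_num), h]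
      · have h := h4 _ (index_lt ht hi)
        rw [zero_add] at h
        simp only [entry]
        push_cast at h ⊢
        exact h

end ImbalanceProgram

/-! ### The imbalance as the objective of the integer program -/

namespace Imbalance

open Finset ImbalanceProgram BlockProgram

variable {V : Type*} [Fintype V] {G : SimpleGraph V} {C : Set V} {k T : ℕ}

theorem mem_iff_lt_card_of_lower {S : Finset (Fin k)} (hS : ∀ i j : Fin k, i < j → j ∈ S → i ∈ S)
    (j : Fin k) : j ∈ S ↔ (j : ℕ) < #S := by
  constructor
  · intro hj
    have h : Iic j ⊆ S := fun i hi => by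
      rcases (mem_Iic.1 hi).lt_or_eq with h | rfl
      · exact hS i j h hj
      · exact hj
    have := card_le_card h
    rw [Fin.card_Iic] at this
    omega
  · intro hj
    by_contra hcon
    have h : S ⊆ Iio j := fun i hi => by
      rw [mem_Iio]
      by_contra h
      rcases (not_lt.1 h).lt_or_eq with h | rfl
      · exact hcon (hS j i h hi)
      · exact hcon hi
    have := card_le_card h
    rw [Fin.card_Iio] at this
    omega

open Classical in
theorem right_sub_left (G : SimpleGraph V) (π : Ordering V) (v : V) :
    ((right G π v).ncard : ℤ) - (left G π v).ncard =
      ∑ u, if G.Adj v u then (if π v < π u then 1 else -1) else 0 := by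
  rw [Set.ncard_eq_toFinset_card', Set.ncard_eq_toFinset_card', right, left]
  simp only [Set.toFinset_ofPred, card_filter]
  push_cast
  rw [← sum_sub_distrib]
  refine sum_congr rfl fun u _ => ?_
  by_cases h : G.Adj v u
  · have hne : π v ≠ π u := fun e => h.ne (π.injective e)
    rcases hne.lt_or_gt with h' | h'
    · simp [h, h', h'.not_gt]
    · simp [h, h', h'.not_gt]
  · simp [h]

open Classical in
theorem sum_eq_cover_add (c : Fin k ≃ C) (σ : Equiv.Perm (Fin k)) (f : V → ℤ) :
    ∑ v, f v = ∑ j, f (c (σ j)) + ∑ v, if v ∈ C then 0 else f v := by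
  have h1 : ∑ j, f (c (σ j)) = ∑ v, if v ∈ C then f v else 0 := by
    rw [← sum_filter]
    exact ((σ.trans c).sum_comp fun u : C => f u).trans (sum_subtype _ (by simp) _).symm
  rw [h1, ← sum_add_distrib]
  refine sum_congr rfl fun v _ => ?_
  split_ifs <;> simp

/-- The cover vertices appear in the order `σ`. -/
def Sorted (c : Fin k ≃ C) (π : Ordering V) (σ : Equiv.Perm (Fin k)) : Prop :=
  ∀ i j : Fin k, i < j → π (c (σ i)) < π (c (σ j))

theorem exists_sorted (c : Fin k ≃ C) (π : Ordering V) : ∃ σ, Sorted c π σ := by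
  refine ⟨Tuple.sort fun j => π (c j), fun i j hij => ?_⟩
  refine lt_of_le_of_ne (Tuple.monotone_sort (fun j => π (c j)) hij.le) fun h => hij.ne ?_
  exact (Tuple.sort fun j => π (c j)).injective (c.injective (Subtype.ext (π.injective h)))

variable {c : Fin k ≃ C} {π : Ordering V} {σ : Equiv.Perm (Fin k)}

theorem Sorted.lt_iff (h : Sorted c π σ) (i j : Fin k) : π (c (σ i)) < π (c (σ j)) ↔ i < j := by
  refine ⟨fun hlt => ?_, h i j⟩
  by_contra hij
  rcases (not_lt.1 hij).lt_or_eq with h' | rfl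
  · exact (h j i h').not_gt hlt
  · exact hlt.false

open Classical in
theorem slot_eq_card (c : Fin k ≃ C) (π : Ordering V) (σ : Equiv.Perm (Fin k)) (v : V) :
    slot C π v = #{j | π (c (σ j)) < π v} := by
  have h : {u | u ∈ C ∧ π u < π v} =
      (fun j => (c (σ j) : V)) '' {j | π (c (σ j)) < π v} := by
    ext u
    constructor
    · rintro ⟨hu, hlt⟩
      exact ⟨σ.symm (c.symm ⟨u, hu⟩), by simpa using hlt, by simp⟩
    · rintro ⟨j, hj, rfl⟩
      exact ⟨(c (σ j)).2, hj⟩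
  have hinj : Function.Injective fun j => (c (σ j) : V) :=
    Subtype.val_injective.comp (c.injective.comp σ.injective)
  rw [slot, h, Set.ncard_image_of_injective _ hinj, Set.ncard_eq_toFinset_card']
  simp

theorem slot_lt (c : Fin k ≃ C) (π : Ordering V) (v : V) : slot C π v < k + 1 := by
  rw [slot_eq_card c π (Equiv.refl _)]
  exact Nat.lt_succ_of_le ((card_le_univ _).trans (by simp))

/-- The cover vertices to the left of `v` form an initial segment of the sorted cover, and the slot
is its length. -/
theorem Sorted.lt_slot_iff (h : Sorted c π σ) (v : V) (j : Fin k) :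
    π (c (σ j)) < π v ↔ (j : ℕ) < slot C π v := by
  classical
  rw [slot_eq_card c π σ, ← mem_iff_lt_card_of_lower]
  · simp
  · intro i j hij hj
    simp only [mem_filter, mem_univ, true_and] at hj ⊢
    exact (h i j hij).trans hj

/-- The number of vertices of each type in each slot. -/
noncomputable def slotCounts (G : SimpleGraph V) (τ : Fin T ≃ vertexTypes G C) (π : Ordering V)
    (t i : ℕ) : ℤ :=
  if h : t < T then ({v | v ∉ C ∧ G.neighborSet v = τ ⟨t, h⟩ ∧ slot C π v = i}.ncard : ℤ) else 0

/-- The number of vertices of each type. -/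
noncomputable def typeCounts (G : SimpleGraph V) (τ : Fin T ≃ vertexTypes G C) (t : ℕ) : ℕ :=
  if h : t < T then {v | v ∉ C ∧ G.neighborSet v = τ ⟨t, h⟩}.ncard else 0

variable {τ : Fin T ≃ vertexTypes G C}

omit [Fintype V] in
theorem exists_type (τ : Fin T ≃ vertexTypes G C) {v : V} (hv : v ∉ C) :
    ∃ t, G.neighborSet v = τ t :=
  ⟨τ.symm ⟨G.neighborSet v, v, hv, rfl⟩, by simp⟩

omit [Fintype V] in
theorem type_unique {v : V} {t t' : Fin T} (h : G.neighborSet v = τ t)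
    (h' : G.neighborSet v = τ t') : t = t' :=
  τ.injective (Subtype.ext (h.symm.trans h'))

open Classical in
-- Outside the cover, type and slot determine the summand, and every vertex has exactly one type and
-- one slot.
theorem sum_outside (c : Fin k ≃ C) (π : Ordering V) (f : V → ℤ) (g : ℕ → ℕ → ℤ)
    (hf : ∀ v ∉ C, ∀ t : Fin T, G.neighborSet v = τ t → f v = g t (slot C π v)) :
    ∑ v, (if v ∈ C then 0 else f v) =
      ∑ t ∈ range T, ∑ i ∈ range (k + 1), g t i * slotCounts G τ π t i := by
  have h1 : ∀ v, (if v ∈ C then 0 else f v) = ∑ t : Fin T, ∑ i ∈ range (k + 1),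
      if v ∉ C ∧ G.neighborSet v = τ t ∧ slot C π v = i then g t i else 0 := by
    intro v
    split_ifs with hv
    · simp [hv]
    · obtain ⟨t, ht⟩ := exists_type τ hv
      rw [sum_eq_single t, sum_eq_single (slot C π v)]
      · simp [hv, ht, hf v hv t ht]
      · intro i _ hi; rw [if_neg]; rintro ⟨-, -, rfl⟩; exact hi rfl
      · intro h; exact absurd (mem_range.2 (slot_lt c π v)) h
      · intro t' _ ht'
        refine sum_eq_zero fun i _ => if_neg ?_
        rintro ⟨-, h, -⟩
        exact ht' (type_unique h ht)
      · simp
  rw [sum_congr rfl fun v _ => h1 v, sum_comm, sum_range]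
  refine sum_congr rfl fun t _ => ?_
  rw [sum_comm]
  refine sum_congr rfl fun i _ => ?_
  rw [slotCounts, dif_pos t.2, Set.ncard_eq_toFinset_card', ← sum_filter, sum_const]
  simp [mul_comm]

theorem feasible_slotCounts (c : Fin k ≃ C) (τ : Fin T ≃ vertexTypes G C) (π : Ordering V) :
    Feasible k T (fun t => (typeCounts G τ t : ℤ)) (slotCounts G τ π) := by
  classical
  intro t ht
  refine ⟨fun i _ => by rw [slotCounts, dif_pos ht]; positivity, ?_⟩
  -- Applied to the indicator of type `t`, the regrouping says that the slot counts of the type add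
  -- up to its number of vertices.
  have h := sum_outside (τ := τ) c π (fun v => if G.neighborSet v = τ ⟨t, ht⟩ then 1 else 0)
    (fun t' _ => if t' = t then 1 else 0) fun v hv t' h' => by
      congr 1
      rw [h', eq_iff_iff, ← Subtype.ext_iff, τ.injective.eq_iff, Fin.ext_iff]
  have h2 : ∑ t' ∈ range T, ∑ i ∈ range (k + 1), (if t' = t then 1 else 0) * slotCounts G τ π t' i =
      ∑ i ∈ range (k + 1), slotCounts G τ π t i := by
    rw [sum_eq_single t]
    · simp
    · intro t' _ h; simp [h]
    · intro h; exact absurd (mem_range.2 ht) h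
  beta_reduce
  rw [← h2, ← h, typeCounts, dif_pos ht, Set.ncard_eq_toFinset_card']
  simp only [Set.toFinset_ofPred, card_filter]
  push_cast
  refine sum_congr rfl fun v _ => ?_
  by_cases hv : v ∈ C <;> simp [hv]

theorem sum_typeCounts_le (τ : Fin T ≃ vertexTypes G C) :
    ∑ t ∈ range T, typeCounts G τ t ≤ Fintype.card V := by
  classical
  rw [sum_range]
  have h : ∀ t : Fin T, typeCounts G τ t = #{v | v ∉ C ∧ G.neighborSet v = τ t} := fun t => by
    rw [typeCounts, dif_pos t.2, Set.ncard_eq_toFinset_card']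
    simp
  simp only [h]
  rw [← card_biUnion]
  · exact card_le_univ _
  · intro t _ t' _ htt'
    rw [Function.onFun, disjoint_left]
    intro v hv hv'
    exact htt' (type_unique (mem_filter.1 hv).2.2 (mem_filter.1 hv').2.2)

section Input

theorem pair_unique {k a b : ℕ} {i j : ℕ} (hi : i < k) (hj : j < k) (h : a * k + i = b * k + j) :
    a = b ∧ i = j := by
  have hk : 0 < k := by omega
  have h1 := congrArg (· / k) h
  simp only [Nat.mul_comm _ k, Nat.mul_add_div hk, Nat.div_eq_of_lt hi, Nat.div_eq_of_lt hj,
    add_zero] at h1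
  subst h1
  exact ⟨rfl, by omega⟩

omit [Fintype V] in
open Classical in
theorem input_cover (i j : Fin k) :
    (input G c τ).arr 0 ((i : ℕ) * k + (j : ℕ)) = if G.Adj (c i) (c j) then 1 else 0 := by
  simp only [input, if_true]
  refine if_congr ⟨?_, fun h => ⟨i, j, rfl, h⟩⟩ rfl rfl
  rintro ⟨i', j', h, hadj⟩
  obtain ⟨h1, h2⟩ := pair_unique j.2 j'.2 (by exact_mod_cast h)
  rwa [Fin.ext h1, Fin.ext h2]

omit [Fintype V] in
open Classical in
theorem input_type (t : Fin T) (i : Fin k) :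
    (input G c τ).arr 1 ((t : ℕ) * k + (i : ℕ)) = if (c i : V) ∈ (τ t : Set V) then 1 else 0 := by
  simp only [input, one_ne_zero, if_false, if_true]
  refine if_congr ⟨?_, fun h => ⟨t, i, rfl, h⟩⟩ rfl rfl
  rintro ⟨t', i', h, hmem⟩
  obtain ⟨h1, h2⟩ := pair_unique i.2 i'.2 (by exact_mod_cast h)
  rwa [Fin.ext h1, Fin.ext h2]

omit [Fintype V] in
theorem input_count {t : ℕ} (ht : t < T) : (input G c τ).arr 2 t = typeCounts G τ t := by
  simp only [input, OfNat.ofNat_ne_zero, OfNat.ofNat_ne_one, if_false, if_true]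
  rw [sum_eq_single ⟨t, ht⟩]
  · simp [typeCounts, ht]
  · intro t' _ h
    rw [if_neg]
    intro h'
    exact h (Fin.ext (by simpa using (by exact_mod_cast h'.symm : (t' : ℕ) = t)))
  · simp

end Input

omit [Fintype V] in
open Classical in
theorem coefficient_input {q : ℕ} (hσ : ∀ j : Fin k, order k q j = σ j) (j : Fin k) (t : Fin T)
    (i : ℕ) : coefficient (input G c τ).arr k q j t i =
      if (c (σ j) : V) ∈ (τ t : Set V) then (if (j : ℕ) < i then 1 else -1) else 0 := by
  rw [coefficient, hσ, input_type]
  split_ifs <;> simp_all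

omit [Fintype V] in
open Classical in
theorem offset_input {q : ℕ} (hσ : ∀ j : Fin k, order k q j = σ j) (j : Fin k) :
    offset (input G c τ).arr k q j =
      ∑ j', if G.Adj (c (σ j)) (c (σ j')) then (if j < j' then 1 else -1) else 0 := by
  rw [offset, sum_range]
  refine sum_congr rfl fun j' _ => ?_
  rw [hσ, hσ, input_cover]
  split_ifs <;> simp_all

/-- Neighbours of an outside vertex are cover vertices, which gives the weights. For a cover vertex,
the neighbours outside give the linear form and those in the cover give the offset. -/
theorem imbalance_eq_cost (hC : G.IsVertexCover C) (hs : Sorted c π σ) {q : ℕ}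
    (hσ : ∀ j : Fin k, order k q j = σ j) :
    imbalance G π = cost (input G c τ).arr k T q
      (fun j => -offset (input G c τ).arr k q j) (slotCounts G τ π) := by
  classical
  have hout : ∀ v ∉ C, ∀ t : Fin T, G.neighborSet v = τ t → ∀ j : Fin k,
      ((c (σ j) : V) ∈ (τ t : Set V) ↔ G.Adj v (c (σ j))) := by
    intro v _ t ht j
    rw [← ht, SimpleGraph.mem_neighborSet]
  have hne : ∀ v ∉ C, ∀ j : Fin k, π v ≠ π (c (σ j)) := fun v hv j h =>
    hv (π.injective h ▸ (c (σ j)).2)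
  have houtside : ∀ v ∉ C, ∀ t : Fin T, G.neighborSet v = τ t →
      imbalanceAt G π v = weight (input G c τ).arr k q t (slot C π v) := by
    intro v hv t ht
    -- A coefficient is signed from the side of the cover vertex; seen from the outside vertex the
    -- signs are opposite, which the absolute value ignores.
    rw [imbalanceAt, right_sub_left, sum_eq_cover_add c σ, weight, ← abs_neg, sum_range]
    -- An edge between two vertices outside the cover would be uncovered.
    have h0 : ∑ u, (if u ∈ C then (0 : ℤ) else
        if G.Adj v u then (if π v < π u then 1 else -1) else 0) = 0 := by
      refine sum_eq_zero fun u _ => ?_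
      split_ifs with h1 h2 <;> first | rfl | exact absurd (hC h2) (by simp [hv, h1])
    rw [h0, add_zero, ← sum_neg_distrib]
    congr 1
    refine sum_congr rfl fun j _ => ?_
    rw [coefficient_input hσ]
    simp only [hout v hv t ht, ← hs.lt_slot_iff]
    rcases (hne v hv j).lt_or_gt with h | h
    · split_ifs <;> simp_all [h.not_gt]
    · split_ifs <;> simp_all [h.not_gt]
  have hinside : ∀ j : Fin k, imbalanceAt G π (c (σ j)) =
      |form k T (coefficient (input G c τ).arr k q) (slotCounts G τ π) j -
        -offset (input G c τ).arr k q j| := by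
    intro j
    rw [imbalanceAt, right_sub_left, sum_eq_cover_add c σ, offset_input hσ, sub_neg_eq_add, add_comm,
      form]
    congr 2
    · refine sum_outside c π _ _ fun v hv t ht => ?_
      rw [coefficient_input hσ]
      simp only [hout v hv t ht, ← hs.lt_slot_iff, G.adj_comm v]
    · refine sum_congr rfl fun j' _ => ?_
      simp only [hs.lt_iff]
  rw [imbalance, sum_eq_cover_add c σ, cost, value, add_comm, sum_range (n := k)]
  congr 1
  · exact sum_outside c π _ _ houtside
  · exact sum_congr rfl fun j _ => hinside j

end Imbalance

/-! ### Numbering of the orders of the cover, and the size of the time bound -/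

namespace ImbalanceProgram

open Finset BlockProgram RAM

theorem collisions_lt_one {k q : ℕ} :
    collisions k q < 1 ↔ ∀ j < k, ∀ j' < k, j < j' → digit k q j ≠ digit k q j' := by
  have hnn : ∀ j ∈ range k, ∀ j' ∈ range k, (0 : ℤ) ≤ if (j : ℤ) < j' then
      (if (digit k q j : ℤ) < digit k q j' then 0
        else if (digit k q j' : ℤ) < digit k q j then 0 else 1) else 0 := by
    intro j _ j' _
    split_ifs <;> simp
  constructor
  · intro h j hj j' hj' hlt heq
    have h0 : collisions k q = 0 := by
      have : 0 ≤ collisions k q := sum_nonneg fun j hj => sum_nonneg (hnn j hj)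
      omega
    have h1 := (sum_eq_zero_iff_of_nonneg fun j hj => sum_nonneg (hnn j hj)).1 h0 j
      (mem_range.2 hj)
    have h2 := (sum_eq_zero_iff_of_nonneg (hnn j (mem_range.2 hj))).1 h1 j' (mem_range.2 hj')
    simp [hlt, heq] at h2
  · intro h
    rw [collisions, sum_eq_zero]
    · exact zero_lt_one
    · intro j hj
      refine sum_eq_zero fun j' hj' => ?_
      have := h j (mem_range.1 hj) j' (mem_range.1 hj')
      split_ifs <;> omega

theorem order_injective {k q j j' : ℕ} (hj : j < k) (hj' : j' < k)
    (h : order k q j = order k q j') : j = j' := by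
  unfold order at h
  split_ifs at h with hc
  · rw [collisions_lt_one] at hc
    by_contra hne
    rcases lt_or_gt_of_ne hne with hlt | hlt
    · exact hc j hj j' hj' hlt h
    · exact hc j' hj' j hj hlt h.symm
  · exact h

/-- Because repeated digits are replaced by the identity, every number stands for a permutation, and
the program need not skip any. -/
theorem exists_perm_eq_order {k : ℕ} (hk : 1 ≤ k) (q : ℕ) :
    ∃ σ : Equiv.Perm (Fin k), ∀ j : Fin k, order k q j = σ j := by
  let f : Fin k → Fin k := fun j => ⟨order k q j, order_lt hk j.2⟩
  have hf : Function.Injective f := fun i j h =>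
    Fin.ext (order_injective i.2 j.2 (congrArg Fin.val h))
  exact ⟨Equiv.ofBijective f (Finite.injective_iff_bijective.1 hf), fun j => rfl⟩

theorem exists_order_eq_perm {k : ℕ} (σ : Equiv.Perm (Fin k)) :
    ∃ q < k ^ k, ∀ j : Fin k, order k q j = σ j := by
  obtain ⟨q, hq, h⟩ := exists_digits (b := k) (n := k)
    (fun j => if hj : j < k then (σ ⟨j, hj⟩ : ℕ) else 0) fun j hj => by simp [hj]
  have hd : ∀ j : Fin k, digit k q j = σ j := fun j => by
    have := h j j.2
    simpa [digit] using this
  refine ⟨q, hq, fun j => ?_⟩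
  rw [order, if_pos, hd]
  rw [collisions_lt_one]
  intro j hj j' hj' hlt heq
  have h1 := hd ⟨j, hj⟩
  have h2 := hd ⟨j', hj'⟩
  simp only at h1 h2
  rw [heq, h2] at h1
  have := σ.injective (Fin.ext h1)
  simp only [Fin.mk.injEq] at this
  omega

/-- The parameter of the time bounds. -/
def loopBound (k T : ℕ) : ℕ := side k T ^ k * side k T ^ k

theorem bounds_loopBound {k T : ℕ} (hk : 1 ≤ k) : Bounds (loopBound k T) k T := by
  have hTk : T ≤ T * k := Nat.le_mul_of_pos_right _ hk
  have hside : side k T = 8 * (T * k) + 16 * k + 1 := by unfold side; ring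
  have h1 : side k T ≤ side k T ^ k := Nat.le_self_pow (by omega) _
  have h2 : 2 * side k T ^ k ≤ loopBound k T := Nat.mul_le_mul_right _ (by omega)
  have h3 : T * (k + 1) ≤ side k T := by rw [Nat.mul_succ]; omega
  have h4 : k ^ k ≤ side k T ^ k := Nat.pow_le_pow_left (by omega) _
  refine ⟨hk, by omega, by omega, by omega, by omega, by omega, by omega, by omega, le_rfl, ?_, ?_⟩
  · exact Nat.mul_le_mul_left _ (by omega)
  · exact Nat.mul_le_mul_left _ (by omega)

/-- With y = (T+2)k ≥ 2, the side 8y + 1 is at most 16y ≤ y^5. -/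
theorem loopBound_le {k T : ℕ} (hk : 1 ≤ k) : loopBound k T ≤ ((T + 2) * k) ^ (10 * k) := by
  have h2 : 2 ≤ (T + 2) * k := by nlinarith
  have h4 : 2 ^ 4 ≤ ((T + 2) * k) ^ 4 := Nat.pow_le_pow_left h2 4
  have h : side k T ≤ ((T + 2) * k) ^ 5 := by
    rw [pow_succ _ 4]
    unfold side
    nlinarith
  calc loopBound k T ≤ (((T + 2) * k) ^ 5) ^ k * (((T + 2) * k) ^ 5) ^ k :=
        Nat.mul_le_mul (Nat.pow_le_pow_left h _) (Nat.pow_le_pow_left h _)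
    _ = ((T + 2) * k) ^ (10 * k) := by rw [← pow_mul, ← pow_add]; congr 1; ring

theorem time_bound {k T n m t c : ℕ} (hk : 1 ≤ k) (hn : 2 ≤ n) (hm : m ≤ n)
    (ht : t ≤ loopBound k T ^ c * (m.size + 1)) :
    (t : ℝ) ≤ (((T : ℝ) + 2) * k) ^ ((10 * c + 2) * k) * Real.logb 2 ((k : ℝ) * n) := by
  have hk' : (1 : ℝ) ≤ k := by exact_mod_cast hk
  have hn' : (2 : ℝ) ≤ n := by exact_mod_cast hn
  have hlog : Real.logb 2 n ≤ Real.logb 2 (k * n) :=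
    Real.logb_le_logb_of_le one_lt_two (by linarith) (by nlinarith)
  have hlog1 : 1 ≤ Real.logb 2 n := by
    rw [Real.le_logb_iff_rpow_le one_lt_two (by linarith)]
    simpa using hn'
  have hsize : ((m.size : ℕ) : ℝ) ≤ Real.logb 2 n + 1 := by
    rcases Nat.eq_zero_or_pos m with rfl | hpos
    · simp; linarith
    · have h1 : 2 ^ (m.size - 1) ≤ m := Nat.lt_size.1 (by
        have := Nat.size_pos.2 hpos; omega)
      have h2 : ((m.size - 1 : ℕ) : ℝ) ≤ Real.logb 2 n := by
        rw [Real.le_logb_iff_rpow_le one_lt_two (by linarith), Real.rpow_natCast]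
        exact_mod_cast h1.trans hm
      have h3 : (m.size : ℝ) ≤ ((m.size - 1 : ℕ) : ℝ) + 1 := by
        exact_mod_cast (by omega : m.size ≤ m.size - 1 + 1)
      linarith
  have h3 : 3 * loopBound k T ^ c ≤ ((T + 2) * k) ^ ((10 * c + 2) * k) := by
    have h2 : 2 ≤ (T + 2) * k := by nlinarith
    calc 3 * loopBound k T ^ c ≤ ((T + 2) * k) ^ (2 * k) * (((T + 2) * k) ^ (10 * k)) ^ c := by
          refine Nat.mul_le_mul ?_ (Nat.pow_le_pow_left (loopBound_le hk) _)
          calc 3 ≤ 2 ^ 2 := by norm_num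
            _ ≤ ((T + 2) * k) ^ 2 := Nat.pow_le_pow_left h2 2
            _ ≤ _ := Nat.pow_le_pow_right (by omega) (by omega)
      _ = _ := by rw [← pow_mul, ← pow_add]; congr 1; ring
  have h3' : (3 : ℝ) * (loopBound k T : ℝ) ^ c ≤ (((T : ℝ) + 2) * k) ^ ((10 * c + 2) * k) := by
    exact_mod_cast h3
  calc (t : ℝ) ≤ (loopBound k T : ℝ) ^ c * (m.size + 1) := by exact_mod_cast ht
    _ ≤ (loopBound k T : ℝ) ^ c * (3 * Real.logb 2 (k * n)) := by
        -- The number of bits plus one is at most log n + 2, and log(kn) ≥ log n ≥ 1 because n ≥ 2.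
        refine mul_le_mul_of_nonneg_left ?_ (by positivity)
        linarith
    _ = 3 * (loopBound k T : ℝ) ^ c * Real.logb 2 (k * n) := by ring
    _ ≤ _ := mul_le_mul_of_nonneg_right h3' (by linarith)

end ImbalanceProgram

/-! ### Realising slot counts by orderings -/

namespace Imbalance

open Finset ImbalanceProgram BlockProgram

/-- Induction on the number of values: cut off a subset of the size prescribed for the last value.
-/
theorem exists_function_of_card {V : Type*} [DecidableEq V] (n : ℕ → ℕ) (m : ℕ) :
    ∀ S : Finset V, ∑ i ∈ range m, n i = #S →
      ∃ s : V → ℕ, (∀ v ∈ S, s v < m) ∧ ∀ i < m, #{v ∈ S | s v = i} = n i := by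
  induction m with
  | zero =>
    intro S hS
    have : S = ∅ := card_eq_zero.1 (by simpa using hS.symm)
    exact ⟨fun _ => 0, by simp [this], by simp⟩
  | succ m ih =>
    intro S hS
    rw [sum_range_succ] at hS
    obtain ⟨U, hU, hcard⟩ := exists_subset_card_eq (s := S) (n := n m) (by omega)
    obtain ⟨s, hs, hs'⟩ := ih (S \ U) (by rw [card_sdiff_of_subset hU]; omega)
    refine ⟨fun v => if v ∈ U then m else s v, fun v hv => ?_, fun i hi => ?_⟩
    · simp only
      split_ifs with h
      · omega
      · exact (hs v (mem_sdiff.2 ⟨hv, h⟩)).trans m.lt_succ_self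
    · rcases Nat.lt_succ_iff_lt_or_eq.1 hi with h | rfl
      · rw [← hs' i h]
        congr 1
        ext v
        simp only [mem_filter, mem_sdiff]
        by_cases hv : v ∈ U
        · simp [hv, h.ne']
        · simp [hv]
      · rw [← hcard]
        congr 1
        ext v
        simp only [mem_filter]
        constructor
        · rintro ⟨hv, h⟩
          by_contra hvU
          rw [if_neg hvU] at h
          exact (hs v (mem_sdiff.2 ⟨hv, hvU⟩)).ne h
        · intro hv
          exact ⟨hU hv, if_pos hv⟩

variable {V : Type*} [Fintype V] {G : SimpleGraph V} {C : Set V} {k T : ℕ} {c : Fin k ≃ C}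
  {τ : Fin T ≃ vertexTypes G C}

theorem exists_ordering_of_key (key : V → ℕ) :
    ∃ π : Ordering V, ∀ u v, key u < key v → π u < π v := by
  let e := Fintype.equivFin V
  let f : Fin (Fintype.card V) → ℕ := fun x => key (e.symm x)
  refine ⟨e.trans (Tuple.sort f).symm, fun u v h => ?_⟩
  by_contra hcon
  have hmono := Tuple.monotone_sort f (not_lt.1 hcon)
  simp only [Function.comp, Equiv.trans_apply, Equiv.apply_symm_apply, f,
    Equiv.symm_apply_apply] at hmono
  omega

/-- Give the `j`-th cover vertex the key 2j + 1, and an outside vertex meant for slot s the key 2s,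
and sort by keys. Then the `j`-th cover vertex is to the left of that vertex exactly if j < s, so
its slot is s. Ties occur only outside the cover and are irrelevant. -/
theorem exists_ordering (σ : Equiv.Perm (Fin k)) {z : ℕ → ℕ → ℤ}
    (hz : Feasible k T (fun t => (typeCounts G τ t : ℤ)) z) :
    ∃ π : Ordering V, Sorted c π σ ∧ Same k T (slotCounts G τ π) z := by
  classical
  have hex : ∀ t : Fin T, ∃ s : V → ℕ, (∀ v, v ∉ C → G.neighborSet v = τ t → s v < k + 1) ∧
      ∀ i < k + 1, (#{v | (v ∉ C ∧ G.neighborSet v = τ t) ∧ s v = i} : ℤ) = z t i := by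
    intro t
    obtain ⟨hnn, hsum⟩ := hz t t.2
    obtain ⟨s, hs, hs'⟩ := exists_function_of_card (fun i => (z t i).toNat) (k + 1)
      {v | v ∉ C ∧ G.neighborSet v = τ t} (by
        zify
        rw [sum_congr rfl fun i hi => Int.toNat_of_nonneg (hnn i (mem_range.1 hi)), hsum]
        beta_reduce
        rw [typeCounts, dif_pos t.2, Set.ncard_eq_toFinset_card', Set.toFinset_ofPred])
    refine ⟨s, fun v hv hv' => hs v (by simp [hv, hv']), fun i hi => ?_⟩
    have h := hs' i hi
    rw [filter_filter] at h
    rw [h, Int.toNat_of_nonneg (hnn i hi)]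
  choose s hs hs' using hex
  let key : V → ℕ := fun v => if hv : v ∈ C then 2 * (σ.symm (c.symm ⟨v, hv⟩) : ℕ) + 1
    else 2 * s (τ.symm ⟨G.neighborSet v, v, hv, rfl⟩) v
  have hkeyC : ∀ j, key (c (σ j)) = 2 * j + 1 := fun j => by simp [key]
  have hkey : ∀ v ∉ C, ∀ t, G.neighborSet v = τ t → key v = 2 * s t v := by
    intro v hv t ht
    have : τ.symm ⟨G.neighborSet v, v, hv, rfl⟩ = t := by
      rw [Equiv.symm_apply_eq]; exact Subtype.ext ht
    simp only [key, hv, dif_neg, not_false_eq_true, this]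
  obtain ⟨π, hπ⟩ := exists_ordering_of_key key
  have hsorted : Sorted c π σ := fun i j hij => hπ _ _ (by rw [hkeyC, hkeyC]; omega)
  refine ⟨π, hsorted, fun t ht i hi => ?_⟩
  have hslot : ∀ v ∉ C, G.neighborSet v = τ ⟨t, ht⟩ → slot C π v = s ⟨t, ht⟩ v := by
    intro v hv hv'
    have hlt := hs ⟨t, ht⟩ v hv hv'
    have hiff : ∀ j : Fin k, (j : ℕ) < slot C π v ↔ (j : ℕ) < s ⟨t, ht⟩ v := by
      intro j
      rw [← hsorted.lt_slot_iff]
      have h1 := hkeyC j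
      have h2 := hkey v hv _ hv'
      constructor
      · intro h
        by_contra hcon
        exact h.not_gt (hπ _ _ (by omega))
      · intro h
        exact hπ _ _ (by omega)
    have hlt' := slot_lt c π v
    by_contra hne
    rcases lt_or_gt_of_ne hne with h | h
    · have := hiff ⟨slot C π v, by omega⟩
      simp only [lt_self_iff_false, false_iff] at this
      omega
    · have := hiff ⟨s ⟨t, ht⟩ v, by omega⟩
      simp only [lt_self_iff_false, iff_false] at this
      omega
  rw [← hs' ⟨t, ht⟩ i hi, slotCounts, dif_pos ht, Set.ncard_eq_toFinset_card', Set.toFinset_ofPred]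
  congr 2
  ext v
  simp only [mem_filter, mem_univ, true_and]
  constructor
  · rintro ⟨h1, h2, h3⟩
    exact ⟨⟨h1, h2⟩, (hslot v h1 h2).symm.trans h3⟩
  · rintro ⟨⟨h1, h2⟩, h3⟩
    exact ⟨h1, h2, (hslot v h1 h2).trans h3⟩

end Imbalance

/-! ### From the routine to the theorem -/

open ImbalanceProgram Imbalance in
-- Stated for an arbitrary routine so that its exponent `c` remains a variable: for `main` it is a
-- closed term assembled by the constructors, and its value is never needed.
theorem exists_program_of_routine {c : ℕ} (p : RAM.Routine c)
    (hp : ∀ {X Y : ℕ} [X.AtLeastTwo] {A : ℕ → ℤ → ℤ} {Γ : RAM.Ctx} {k T : ℕ}, Bounds X k T →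
      Knows Γ k T → ∀ {n : ℕ → ℕ}, (∑ t ∈ Finset.range T, n t).size ≤ Y →
      (∀ t < T, A 2 t = n t) →
      RAM.Tr X Y Γ p A fun A' => ∃ m < k ^ k, ∃ z, (∀ j < k, A' 3 j = order k m j) ∧
        (∀ t < T, ∀ i < k + 1, A' 4 (t * (k + 1) + i) = z t i) ∧
        BlockProgram.Feasible k T (fun t => n t) z ∧
        ∀ m' < k ^ k, ∀ z', BlockProgram.Feasible k T (fun t => n t) z' →
          cost A k T m (fun j => -offset A k m j) z ≤
            cost A k T m' (fun j => -offset A k m' j) z') :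
    ∃ (p : RAM.Prog) (a : ℕ),
      ∀ (V : Type*) [Fintype V] (G : SimpleGraph V) (C : Set V) (k T : ℕ)
        (c : Fin k ≃ C) (τ : Fin T ≃ Imbalance.vertexTypes G C),
        G.IsVertexCover C → 1 ≤ k → 2 ≤ Fintype.card V →
        ∃ (time : ℕ) (s : RAM.State),
          RAM.Exec p (Imbalance.input G c τ) time s ∧
          (time : ℝ) ≤
            (((T : ℝ) + 2) * k) ^ (a * k) * Real.logb 2 ((k : ℝ) * Fintype.card V) ∧
          (∃ π : Imbalance.Ordering V, Imbalance.Describes G c τ s π) ∧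
          ∀ π : Imbalance.Ordering V, Imbalance.Describes G c τ s π → Imbalance.IsOptimal G π := by
  -- Variables 0 and 1 hold k and T, so 2 is the first free variable.
  refine ⟨p 2, 10 * c + 2, fun V _ G C k T e τ hC hk hn => ?_⟩
  have hB := bounds_loopBound (T := T) hk
  have : (loopBound k T).AtLeastTwo := ⟨by have := hB.five; omega⟩
  obtain ⟨t, s, hexec, ht, ⟨m, hm, z, h3, h4, hz, hopt⟩, -⟩ :=
    hp (Γ := ⟨2, (input G e τ).var⟩) hB ⟨le_rfl, by simp [input], by simp [input]⟩
      (n := typeCounts G τ) le_rfl (fun t ht => input_count ht) 2 le_rfl (input G e τ) rfl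
      (fun _ _ => rfl)
  refine ⟨t, s, hexec, time_bound hk hn (sum_typeCounts_le τ) ht, ?_, fun π hπ ρ => ?_⟩
  · obtain ⟨σ, hσ⟩ := exists_perm_eq_order hk m
    obtain ⟨π, hπ, hsame⟩ := exists_ordering (c := e) σ hz
    refine ⟨π, ⟨σ, hπ, fun i => ?_⟩, fun t i => ?_⟩
    · rw [h3 i i.2, hσ]
    · rw [h4 t t.2 i i.2, ← hsame t t.2 i i.2, slotCounts, dif_pos t.2]
  -- The description fixes the order of the cover and the slot counts, hence the cost. So every
  -- described ordering has the minimum cost that was computed, and any ordering `ρ` is one of the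
  -- competitors.
  · obtain ⟨⟨σ, hσ, hσ3⟩, h4'⟩ := hπ
    have hord : ∀ j : Fin k, order k m j = σ j := fun j => by
      have := (h3 j j.2).symm.trans (hσ3 j)
      exact_mod_cast this
    have hsame : BlockProgram.Same k T (slotCounts G τ π) z := by
      intro t ht i hi
      rw [← h4 t ht i hi, slotCounts, dif_pos ht]
      exact (h4' ⟨t, ht⟩ ⟨i, hi⟩).symm
    obtain ⟨σ', hσ'⟩ := exists_sorted e ρ
    obtain ⟨m', hm', hord'⟩ := exists_order_eq_perm σ'
    rw [imbalance_eq_cost (τ := τ) hC hσ hord, imbalance_eq_cost (τ := τ) hC hσ' hord', cost,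
      BlockProgram.value_congr hsame fun _ _ => rfl]
    exact hopt m' hm' _ (feasible_slotCounts e τ ρ)

theorem corollary4 :
    ∃ (p : RAM.Prog) (a : ℕ),
      ∀ (V : Type*) [Fintype V] (G : SimpleGraph V) (C : Set V) (k T : ℕ)
        (c : Fin k ≃ C) (τ : Fin T ≃ Imbalance.vertexTypes G C),
        G.IsVertexCover C → 1 ≤ k → 2 ≤ Fintype.card V →
        ∃ (time : ℕ) (s : RAM.State),
          RAM.Exec p (Imbalance.input G c τ) time s ∧
          (time : ℝ) ≤
            (((T : ℝ) + 2) * k) ^ (a * k) * Real.logb 2 ((k : ℝ) * Fintype.card V) ∧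
          (∃ π : Imbalance.Ordering V, Imbalance.Describes G c τ s π) ∧
          ∀ π : Imbalance.Ordering V, Imbalance.Describes G c τ s π → Imbalance.IsOptimal G π :=
  exists_program_of_routine ImbalanceProgram.main ImbalanceProgram.tr_main
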